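/- Let $H$ be a real or complex Hilbert space. A family $(f_i)$ in $H$ is a frame for a closed subspace $L$ containing it if there are constants $A,B>0$ with $A\|f\|^2\le\sum_i|\langle f,f_i\rangle|^2\le B\|f\|^2$ for all $f\in L$. A sequence has the subframe property if each of its subfamilies is a frame for its closed linear span; a Riesz frame for $H$ is a frame for $H$ all of whose subfamilies are frames for their closed linear spans with common constants $A,B$. A Riesz basis for $H$ is a family $(g_i)$ with closed linear span $H$ for which there are constants $c,C>0$ with $c\sum|a_i|^2\le\|\sum a_ig_i\|^2\le C\sum|a_i|^2$ for all finitely supported scalar families $(a_i)$; a vector has infinite support with respect to it if infinitely many coefficients of its expansion in $(g_i)$ are nonzero. Let $(f_i)_{i=1}^\infty$ be a sequence which is a frame for $H$. A *decomposition* of $(f_i)_{i=1}^\infty$ is a division of the sequence (that is, of its index set) into three families: a Riesz basis $(g_j)_{j\in J}$ for $H$ (so $J$ is infinite if and only if $\dim H=\infty$), a finite or infinite family $(h_i)_{i\in\Gamma}$, and a finite family $(k_i)_{i=1}^{\ell}$, $\ell\ge 0$, together with a finite set $M\subseteq J$ and vectors $h_i^1,h_i^2$ such that, with $G=\operatorname{span}(g_j)_{j\in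 M}$, - $h_i=h_i^1+h_i^2$, where $h_i^2\in G$ and $h_i^1$ lies in the closed linear span of $(g_j)_{j\in J\setminus M}$, for all $i\in\Gamma$; - each $k_i$ has infinite support with respect to $(g_j)_{j\in J}$; - $\sum_{i\in\Gamma}\|h_i^2\|^2<\infty$; - $((g_j)_{j\in J},(h_i^1)_{i\in\Gamma})$ is a Riesz frame for $H$. For a frame $(f_i)_{i=1}^\infty$ for $H$ let $Sf=\sum_{i=1}^\infty\langle f,f_i\rangle f_i$ be its frame operator, a bijection of $H$, and for each $n$ let $S_nf=\sum_{i=1}^n\langle f,f_i\rangle f_i$, regarded as a bijection of $H_n=\operatorname{span}(f_i)_{i=1}^n$. The *projection method* works for $(f_i)_{i=1}^\infty$ if $\lim_{n\to\infty}\langle f,S_n^{-1}f_i\rangle=\langle f,S^{-1}f_i\rangle$ for all $f\in H$ and all $i$. The *strong projection method* works if for all $f\in H$ $$\lim_{n\to\infty}\Big(\sum_{i=1}^n|\langle f,S_n^{-1}f_i\rangle-\langle f,S^{-1}f_i\rangle|^2+\sum_{i=n+1}^\infty|\langle f,S^{-1}f_i\rangle|^2\Big)=0,$$ where the series $\sum_{i=1}^\infty|\langle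 f,S^{-1}f_i\rangle|^2$ converges. **Theorem 4.1.** Let $(f_i)_{i=1}^\infty$ be a frame for $H$ with the subframe property. Then the following are equivalent: 1. $(f_i)_{i=1}^\infty$ has a decomposition without infinitely supported vectors $k_i$ (that is, with $\ell=0$); 1′. no decomposition of $(f_i)_{i=1}^\infty$ contains an infinitely supported vector $k_i$ (that is, $\ell=0$ in every decomposition); 2. some permutation of $(f_i)_{i=1}^\infty$ satisfies the projection method; 3. every permutation of $(f_i)_{i=1}^\infty$ satisfies the strong projection method. -/

import Mathlib

open Filter Topology

namespace FrameTheory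

noncomputable section

variable (𝕜 : Type*) {H ι : Type*} [RCLike 𝕜] [NormedAddCommGroup H] [InnerProductSpace 𝕜 H]

/-- The closed linear span of a family of vectors. -/
def closedSpan (f : ι → H) : Submodule 𝕜 H :=
  (Submodule.span 𝕜 (Set.range f)).topologicalClosure

/-- The frame inequalities `A ‖x‖² ≤ ∑ᵢ |⟨x, fᵢ⟩|² ≤ B ‖x‖²` for all `x` in the subspace `K`. -/
def FrameBoundsOn (K : Submodule 𝕜 H) (f : ι → H) (A B : ℝ) : Prop :=
  ∀ x ∈ K, Summable (fun i => ‖inner 𝕜 (f i) x‖ ^ 2) ∧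
    A * ‖x‖ ^ 2 ≤ ∑' i, ‖inner 𝕜 (f i) x‖ ^ 2 ∧
    ∑' i, ‖inner 𝕜 (f i) x‖ ^ 2 ≤ B * ‖x‖ ^ 2

/-- `f` is a frame for the whole space `H`. -/
def IsFrame (f : ι → H) : Prop :=
  ∃ A B : ℝ, 0 < A ∧ 0 < B ∧ FrameBoundsOn 𝕜 ⊤ f A B

/-- `f` is a frame for its closed linear span. -/
def IsFrameSequence (f : ι → H) : Prop :=
  ∃ A B : ℝ, 0 < A ∧ 0 < B ∧ FrameBoundsOn 𝕜 (closedSpan 𝕜 f) f A B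

/-- Every subfamily of `f` is a frame for its closed linear span. -/
def HasSubframeProperty (f : ι → H) : Prop :=
  ∀ s : Set ι, IsFrameSequence 𝕜 (fun i : s => f i)

/-- `f` is a frame for `H`, and all subfamilies of `f` are frames for their closed linear spans
with common frame bounds. -/
def IsRieszFrame (f : ι → H) : Prop :=
  IsFrame 𝕜 f ∧ ∃ A B : ℝ, 0 < A ∧ 0 < B ∧
    ∀ s : Set ι, FrameBoundsOn 𝕜 (closedSpan 𝕜 (fun i : s => f i)) (fun i : s => f i) A B

/-- `g` is a Riesz basis for `H`: it is total, and the norm of a linear combination is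
equivalent to the `ℓ²` norm of its coefficients. -/
def IsRieszBasis (g : ι → H) : Prop :=
  closedSpan 𝕜 g = ⊤ ∧ ∃ c C : ℝ, 0 < c ∧ 0 < C ∧ ∀ a : ι →₀ 𝕜,
    c * ∑ i ∈ a.support, ‖a i‖ ^ 2 ≤ ‖∑ i ∈ a.support, a i • g i‖ ^ 2 ∧
    ‖∑ i ∈ a.support, a i • g i‖ ^ 2 ≤ C * ∑ i ∈ a.support, ‖a i‖ ^ 2

/-- `x` has infinite support with respect to `g`: in the expansion `x = ∑ᵢ aᵢ gᵢ` infinitely many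
coefficients are nonzero. (For a Riesz basis `g` the expansion exists and is unique.) -/
def HasInfiniteSupport (g : ι → H) (x : H) : Prop :=
  ∃ a : ι → 𝕜, HasSum (fun i => a i • g i) x ∧ (Function.support a).Infinite

/-- A division of the sequence `f` into a Riesz basis `(f i)_{i ∈ I}`, vectors `(f i)_{i ∈ Γ}`
that are perturbations, inside the finite-dimensional space `G = span (f i)_{i ∈ M}` with `M ⊆ I`
finite, of vectors `h₁` which together with the Riesz basis form a Riesz frame, and
finitely many vectors `(f i)_{i ∈ K}` of infinite support. After relabelling the Riesz basis,
`M` consists of its first `m` members. The complement of `G` in which `h₁` lives is the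
one given by the Riesz basis, the closed span of its remaining members (it is `Gᗮ` once
the Riesz basis is carried to an orthonormal basis). -/
structure SubframeDecomposition (f : ℕ → H) where
  /-- indices of the Riesz basis -/
  I : Set ℕ
  /-- indices of the perturbed vectors -/
  Γ : Set ℕ
  /-- indices of the infinitely supported vectors -/
  K : Finset ℕ
  disjoint_I_Γ : Disjoint I Γ
  disjoint_I_K : Disjoint I (K : Set ℕ)
  disjoint_Γ_K : Disjoint Γ (K : Set ℕ)
  union_eq : I ∪ Γ ∪ (K : Set ℕ) = Set.univ
  rieszBasis : IsRieszBasis 𝕜 (fun i : I => f i)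
  /-- indices of the members of the Riesz basis that span `G` -/
  M : Finset ℕ
  M_subset : (M : Set ℕ) ⊆ I
  h₁ : Γ → H
  h₂ : Γ → H
  add_eq : ∀ i : Γ, f i = h₁ i + h₂ i
  h₂_mem : ∀ i : Γ, h₂ i ∈ Submodule.span 𝕜 (f '' (M : Set ℕ))
  h₁_mem : ∀ i : Γ, h₁ i ∈ closedSpan 𝕜 (fun j : ↥(I \ (M : Set ℕ)) => f j)
  infinite_support : ∀ i ∈ K, HasInfiniteSupport 𝕜 (fun j : I => f j) (f i)
  summable_h₂ : Summable (fun i : Γ => ‖h₂ i‖ ^ 2)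
  rieszFrame : IsRieszFrame 𝕜 (Sum.elim (fun i : I => f i) h₁)

/-- The frame operator `S x = ∑ᵢ ⟨x, fᵢ⟩ fᵢ`. -/
def frameOperator (f : ℕ → H) (x : H) : H :=
  ∑' i, (inner 𝕜 (f i) x : 𝕜) • f i

/-- The dual frame `S⁻¹ fᵢ`. (The frame operator of a frame is a bijection of `H`.) -/
def dualFrame (f : ℕ → H) (i : ℕ) : H :=
  Function.invFun (frameOperator 𝕜 f) (f i)

/-- `Hₙ`, the span of the first `n` vectors. -/
def partialSpan (f : ℕ → H) (n : ℕ) : Submodule 𝕜 H :=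
  Submodule.span 𝕜 (f '' Set.Iio n)

theorem mem_partialSpan (f : ℕ → H) {n i : ℕ} (hi : i < n) : f i ∈ partialSpan 𝕜 f n :=
  Submodule.subset_span ⟨i, hi, rfl⟩

/-- `Sₙ : Hₙ → Hₙ`, the frame operator of the first `n` vectors on their span. -/
def partialFrameOperator (f : ℕ → H) (n : ℕ) : partialSpan 𝕜 f n →ₗ[𝕜] partialSpan 𝕜 f n where
  toFun x := ∑ i : Fin n, (inner 𝕜 (f i) (x : H) : 𝕜) •
    (⟨f i, mem_partialSpan 𝕜 f i.2⟩ : partialSpan 𝕜 f n)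
  map_add' x y := by
    simp only [Submodule.coe_add, inner_add_right, add_smul, Finset.sum_add_distrib]
  map_smul' c x := by
    simp only [Submodule.coe_smul, inner_smul_right, mul_smul, Finset.smul_sum, RingHom.id_apply]

theorem partialFrameOperator_bijective (f : ℕ → H) (n : ℕ) :
    Function.Bijective (partialFrameOperator 𝕜 f n) := by
  have : FiniteDimensional 𝕜 (partialSpan 𝕜 f n) :=
    FiniteDimensional.span_of_finite 𝕜 ((Set.finite_Iio n).image f)
  have hinj : Function.Injective (partialFrameOperator 𝕜 f n) := by
    rw [injective_iff_map_eq_zero]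
    intro x hx
    have h1 : inner 𝕜 (x : H) ((partialFrameOperator 𝕜 f n x : partialSpan 𝕜 f n) : H)
        = ((∑ i : Fin n, ‖inner 𝕜 (f i) (x : H)‖ ^ 2 : ℝ) : 𝕜) := by
      simp only [partialFrameOperator, LinearMap.coe_mk, AddHom.coe_mk,
        Submodule.coe_sum, Submodule.coe_smul, inner_sum, inner_smul_right]
      push_cast
      refine Finset.sum_congr rfl fun i _ => ?_
      rw [← inner_conj_symm (x : H) (f i), RCLike.mul_conj]
    rw [hx] at h1
    simp only [ZeroMemClass.coe_zero, inner_zero_right] at h1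
    have h2 : ∑ i : Fin n, ‖inner 𝕜 (f i) (x : H)‖ ^ 2 = 0 := by exact_mod_cast h1.symm
    rw [Finset.sum_eq_zero_iff_of_nonneg (fun i _ => by positivity)] at h2
    have h3 : partialSpan 𝕜 f n ≤ (𝕜 ∙ (x : H))ᗮ := by
      refine Submodule.span_le.2 ?_
      rintro _ ⟨i, hi, rfl⟩
      have := h2 ⟨i, hi⟩ (Finset.mem_univ _)
      rw [SetLike.mem_coe, Submodule.mem_orthogonal_singleton_iff_inner_left]
      simpa using this
    have h4 := Submodule.mem_orthogonal_singleton_iff_inner_left.1 (h3 x.2)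
    exact Subtype.ext (inner_self_eq_zero.1 h4)
  exact ⟨hinj, LinearMap.injective_iff_surjective.1 hinj⟩

/-- `Sₙ⁻¹ fᵢ ∈ Hₙ` for `i < n` (and `0`, which plays no role, for `n ≤ i`). -/
def partialDual (f : ℕ → H) (n i : ℕ) : H :=
  if hi : i < n then
    ((LinearEquiv.ofBijective (partialFrameOperator 𝕜 f n)
      (partialFrameOperator_bijective 𝕜 f n)).symm ⟨f i, mem_partialSpan 𝕜 f hi⟩ : H)
  else 0

/-- The projection method works for `f`: `⟨x, Sₙ⁻¹ fᵢ⟩ → ⟨x, S⁻¹ fᵢ⟩` for all `x` and `i`. -/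
def ProjectionMethod (f : ℕ → H) : Prop :=
  ∀ (x : H) (i : ℕ), Tendsto (fun n => (inner 𝕜 (partialDual 𝕜 f n i) x : 𝕜)) atTop
    (𝓝 (inner 𝕜 (dualFrame 𝕜 f i) x))

/-- The strong projection method works for `f`: for all `x` the finite sequences
`(⟨x, Sₙ⁻¹ fᵢ⟩)_{i < n}` converge in `ℓ²` to the frame coefficients `⟨x, S⁻¹ fᵢ⟩`. -/
def StrongProjectionMethod (f : ℕ → H) : Prop :=
  ∀ x : H, Summable (fun i => ‖(inner 𝕜 (dualFrame 𝕜 f i) x : 𝕜)‖ ^ 2) ∧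
    Tendsto (fun n : ℕ =>
      ∑ i ∈ Finset.range n,
        ‖(inner 𝕜 (partialDual 𝕜 f n i) x : 𝕜) - inner 𝕜 (dualFrame 𝕜 f i) x‖ ^ 2
      + ∑' j : ℕ, ‖(inner 𝕜 (dualFrame 𝕜 f (n + j)) x : 𝕜)‖ ^ 2) atTop (𝓝 0)

end

end FrameTheory

/-!
For a subfamily indexed by `s`, let `E_s z = ∑_{i ∈ s} |⟨z, fᵢ⟩|²`. The argument rests on a dual form
of the lower frame inequality with bound `A`: for `y` in the span of the subfamily and every `z` in
`H`, `A |⟨y, z⟩|² ≤ ‖y‖² E_s z` (`LowerBound.mul_norm_inner_sq_le`). It can be checked on finite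
linear combinations, is additive in `y`, and behaves well under bounded operators.

*A decomposition without infinitely supported vectors gives the strong projection method.*
Passing from the Riesz frame `(g, h¹)` to `(g, h)` is a square summable perturbation by vectors in
the span of the finite family `(g_j)_{j ∈ M}`, so all subfamilies of `f` that contain this finite
family keep a common lower bound (`LowerBound.exists_of_perturbation`). Thus the initial segments
of any rearrangement eventually have a common lower bound, whence the operators `Sₙ⁻¹` are uniformly
bounded, and `Sₙ⁻¹ Pₙ x - Pₙ S⁻¹ x = Sₙ⁻¹ Pₙ (x - Sₙ S⁻¹ x)` gives the convergence
(`strongProjectionMethod_of_lowerBound`).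

*The projection method excludes infinitely supported vectors.* By Banach–Steinhaus,
`‖Sₙ⁻¹ fᵢ‖` is bounded in `n` for each `i`. Let `V` be the span of the vectors `g` and `h`. All of
them are finite combinations of the Riesz basis, because in a Riesz frame nonzero distances between a
member and the span of finitely many others are bounded below (`mem_span_of_lowerBound`). If `v` in
`V` tends to `k`, then the coefficients at the vectors `k₁, …, k_ℓ` of `k - v` tend to `0`, and since
the relations modulo `V` between finitely many vectors form a closed space, `k` itself lies in `V`
(`ProjectionMethod.mem_span_compl`).

*A decomposition exists.* The subfamilies with lower bound `A` form a closed subset of the Cantor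
space of all subfamilies, so by Baire's theorem some `A` serves all subfamilies with a
prescribed initial pattern, given by a finite set `D` of indices below some `N`. Modulo the span of
`(f i)_{i ∈ D}`, a linearly independent subfamily of the tail then has a lower Riesz bound, since a
lower frame bound of a finite linearly independent family is a lower Riesz bound; a maximal one
spans the tail algebraically. Adjoining finitely many vectors produces a Riesz basis
(`HasSubframeProperty.exists_rieszSubfamily`). The vectors `h¹` are obtained by an oblique projection
along finitely many of its members (`exists_lowerBound_oblique`).
-/

/-! ### Bessel families, energies and lower frame bounds -/

namespace FrameTheory

noncomputable section

variable (𝕜 : Type*) {H ι κ : Type*} [RCLike 𝕜] [NormedAddCommGroup H] [InnerProductSpace 𝕜 H]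

/-- `∑_{i ∈ s} |⟨x, fᵢ⟩|²`, the sum that the frame inequalities of the subfamily indexed by `s`
control. -/
def energy (f : ι → H) (s : Set ι) (x : H) : ℝ := ∑' i : s, ‖inner 𝕜 (f i) x‖ ^ 2

/-- `f` is a Bessel family with bound `B`. -/
structure IsBessel (f : ι → H) (B : ℝ) : Prop where
  nonneg : 0 ≤ B
  summable : ∀ x, Summable fun i => ‖inner 𝕜 (f i) x‖ ^ 2
  le : ∀ x, ∑' i, ‖inner 𝕜 (f i) x‖ ^ 2 ≤ B * ‖x‖ ^ 2

/-- The lower frame inequality of the subfamily indexed by `s`, on the finite linear span of that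
subfamily. -/
def LowerBound (f : ι → H) (s : Set ι) (A : ℝ) : Prop :=
  ∀ x ∈ Submodule.span 𝕜 (f '' s), A * ‖x‖ ^ 2 ≤ energy 𝕜 f s x

variable {𝕜} {f : ι → H} {A B : ℝ} {s t : Set ι}

theorem IsFrame.exists_isBessel (hf : IsFrame 𝕜 f) : ∃ B, IsBessel 𝕜 f B := by
  obtain ⟨A, B, -, hB, h⟩ := hf
  exact ⟨B, hB.le, fun x => (h x trivial).1, fun x => (h x trivial).2.2⟩

theorem energy_nonneg (x : H) : 0 ≤ energy 𝕜 f s x := tsum_nonneg fun _ => by positivity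

theorem energy_univ (x : H) : energy 𝕜 f Set.univ x = ∑' i, ‖inner 𝕜 (f i) x‖ ^ 2 :=
  tsum_univ fun i => ‖inner 𝕜 (f i) x‖ ^ 2

theorem energy_coe (F : Finset ι) (x : H) :
    energy 𝕜 f (F : Set ι) x = ∑ i ∈ F, ‖inner 𝕜 (f i) x‖ ^ 2 :=
  Finset.tsum_subtype F fun i => ‖inner 𝕜 (f i) x‖ ^ 2

theorem energy_congr {g : ι → H} {x y : H} (h : ∀ i ∈ s, ‖inner 𝕜 (f i) x‖ = ‖inner 𝕜 (g i) y‖) :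
    energy 𝕜 f s x = energy 𝕜 g s y :=
  tsum_congr fun i => by rw [h i i.2]

theorem energy_comp_image (e : κ → ι) (he : Function.Injective e) (u : Set κ) (x : H) :
    energy 𝕜 (f ∘ e) u x = energy 𝕜 f (e '' u) x :=
  (Equiv.Set.image e u he).tsum_eq fun i : e '' u => ‖inner 𝕜 (f i) x‖ ^ 2

theorem lowerBound_comp_iff (e : κ → ι) (he : Function.Injective e) (u : Set κ) :
    LowerBound 𝕜 (f ∘ e) u A ↔ LowerBound 𝕜 f (e '' u) A := by
  simp only [LowerBound, energy_comp_image e he, Set.image_comp]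

namespace IsBessel

theorem sum_le (hf : IsBessel 𝕜 f B) (F : Finset ι) (x : H) :
    ∑ i ∈ F, ‖inner 𝕜 (f i) x‖ ^ 2 ≤ B * ‖x‖ ^ 2 :=
  ((hf.summable x).sum_le_tsum F fun _ _ => by positivity).trans (hf.le x)

theorem energy_mono (hf : IsBessel 𝕜 f B) (h : s ⊆ t) (x : H) :
    energy 𝕜 f s x ≤ energy 𝕜 f t x :=
  Summable.tsum_le_tsum_of_inj (Set.inclusion h) (Set.inclusion_injective h)
    (fun _ _ => by positivity) (fun _ => le_rfl) ((hf.summable x).subtype s)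
    ((hf.summable x).subtype t)

theorem energy_le (hf : IsBessel 𝕜 f B) (s : Set ι) (x : H) : energy 𝕜 f s x ≤ B * ‖x‖ ^ 2 :=
  (hf.energy_mono (Set.subset_univ s) x).trans ((energy_univ x).trans_le (hf.le x))

theorem comp (hf : IsBessel 𝕜 f B) {e : κ → ι} (he : Function.Injective e) :
    IsBessel 𝕜 (f ∘ e) B where
  nonneg := hf.nonneg
  summable x := (hf.summable x).comp_injective he
  le x := by
    have h := energy_comp_image (𝕜 := 𝕜) (f := f) e he Set.univ x
    rw [energy_univ] at h
    exact h.trans_le (hf.energy_le _ x)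

theorem subtype (hf : IsBessel 𝕜 f B) (s : Set ι) : IsBessel 𝕜 (fun i : s => f i) B :=
  hf.comp Subtype.val_injective

theorem map [CompleteSpace H] (hf : IsBessel 𝕜 f B) (T : H →L[𝕜] H) :
    IsBessel 𝕜 (fun i => T (f i)) (B * ‖T‖ ^ 2) where
  nonneg := mul_nonneg hf.nonneg (by positivity)
  summable x := by
    simpa only [← ContinuousLinearMap.adjoint_inner_right] using
      hf.summable (ContinuousLinearMap.adjoint T x)
  le x := by
    simp only [← ContinuousLinearMap.adjoint_inner_right]
    refine (hf.le _).trans ?_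
    have h := (ContinuousLinearMap.adjoint T).le_opNorm x
    rw [LinearIsometryEquiv.norm_map] at h
    rw [mul_assoc, ← mul_pow]
    exact mul_le_mul_of_nonneg_left (pow_le_pow_left₀ (norm_nonneg _) h 2) hf.nonneg

/-- The analysis operator `x ↦ (⟨x, fᵢ⟩)ᵢ` of a Bessel family. -/
def analysis (hf : IsBessel 𝕜 f B) : H →L[𝕜] lp (fun _ : ι => 𝕜) 2 :=
  LinearMap.mkContinuous
    { toFun := fun x => ⟨fun i => inner 𝕜 (f i) x, memℓp_gen (by simpa using hf.summable x)⟩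
      map_add' := fun x y => by ext i; exact inner_add_right _ _ _
      map_smul' := fun c x => by ext i; exact inner_smul_right _ _ _ }
    (√B) (fun x => by
      rw [← Real.sqrt_sq (norm_nonneg x), ← Real.sqrt_mul hf.nonneg]
      refine Real.le_sqrt_of_sq_le ?_
      have h := lp.norm_rpow_eq_tsum (p := 2) (by norm_num) (E := fun _ : ι => 𝕜)
        ⟨fun i => inner 𝕜 (f i) x, memℓp_gen (by simpa using hf.summable x)⟩
      simp only [ENNReal.toReal_ofNat, Real.rpow_ofNat] at h
      exact h.trans_le (hf.le x))

theorem analysis_apply (hf : IsBessel 𝕜 f B) (x : H) (i : ι) :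
    hf.analysis x i = inner 𝕜 (f i) x := rfl

theorem norm_analysis_sq (hf : IsBessel 𝕜 f B) (x : H) :
    ‖hf.analysis x‖ ^ 2 = ∑' i, ‖inner 𝕜 (f i) x‖ ^ 2 := by
  have h := lp.norm_rpow_eq_tsum (p := 2) (by norm_num) (hf.analysis x)
  simp only [ENNReal.toReal_ofNat, Real.rpow_ofNat] at h
  exact h

theorem norm_analysis_subtype_sq (hf : IsBessel 𝕜 f B) (s : Set ι) (x : H) :
    ‖(hf.subtype s).analysis x‖ ^ 2 = energy 𝕜 f s x :=
  (hf.subtype s).norm_analysis_sq x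

variable [CompleteSpace H]

/-- The frame operator of a Bessel family as a bounded operator. -/
def frameOp (hf : IsBessel 𝕜 f B) : H →L[𝕜] H :=
  (ContinuousLinearMap.adjoint hf.analysis).comp hf.analysis

theorem hasSum_frameOp (hf : IsBessel 𝕜 f B) (x : H) :
    HasSum (fun i => (inner 𝕜 (f i) x : 𝕜) • f i) (hf.frameOp x) := by
  classical
  have h := (lp.hasSum_single (p := 2) (by norm_num) (hf.analysis x)).mapL
    (ContinuousLinearMap.adjoint hf.analysis)
  have e : ∀ i, ContinuousLinearMap.adjoint hf.analysis (lp.single 2 i (hf.analysis x i))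
      = (inner 𝕜 (f i) x : 𝕜) • f i := fun i => by
    refine ext_inner_right 𝕜 fun y => ?_
    rw [ContinuousLinearMap.adjoint_inner_left, lp.inner_single_left, inner_smul_left]
    simp [analysis_apply, mul_comm]
  simp only [e] at h
  exact h

theorem inner_frameOp (hf : IsBessel 𝕜 f B) (x y : H) :
    inner 𝕜 (hf.frameOp x) y = inner 𝕜 x (hf.frameOp y) := by
  simp [frameOp, ContinuousLinearMap.adjoint_inner_left, ContinuousLinearMap.adjoint_inner_right]

theorem frameOp_bijective (hf : IsBessel 𝕜 f B) (hA : 0 < A)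
    (h : ∀ x, A * ‖x‖ ^ 2 ≤ ∑' i, ‖inner 𝕜 (f i) x‖ ^ 2) : Function.Bijective hf.frameOp := by
  rw [← ContinuousLinearMap.isUnit_iff_bijective]
  refine ContinuousLinearMap.isUnit_of_forall_le_norm_inner_map _ (c := ⟨A, hA.le⟩) hA fun x => ?_
  rw [frameOp, ContinuousLinearMap.comp_apply, ContinuousLinearMap.adjoint_inner_left,
    inner_self_eq_norm_sq_to_K, norm_pow, RCLike.norm_ofReal, abs_norm, norm_analysis_sq]
  exact (mul_comm _ _).trans_le (h x)

end IsBessel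

/-- The lower frame inequality passes from the linear span to its closure. -/
theorem LowerBound.le_of_mem_closure (h : LowerBound 𝕜 f s A) (hf : IsBessel 𝕜 f B)
    {x : H} (hx : x ∈ (Submodule.span 𝕜 (f '' s)).topologicalClosure) :
    A * ‖x‖ ^ 2 ≤ energy 𝕜 f s x := by
  have hc : IsClosed {x : H | A * ‖x‖ ^ 2 ≤ energy 𝕜 f s x} := by
    simp only [← hf.norm_analysis_subtype_sq]
    exact isClosed_le (by fun_prop) (by fun_prop)
  exact closure_minimal (s := (Submodule.span 𝕜 (f '' s) : Set H)) h hc hx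

theorem closedSpan_subtype (f : ι → H) (s : Set ι) :
    closedSpan 𝕜 (fun i : s => f i) = (Submodule.span 𝕜 (f '' s)).topologicalClosure := by
  rw [closedSpan, Set.image_eq_range]

theorem LowerBound.frameBoundsOn (h : LowerBound 𝕜 f s A) (hf : IsBessel 𝕜 f B) :
    FrameBoundsOn 𝕜 (closedSpan 𝕜 (fun i : s => f i)) (fun i : s => f i) A B := fun x hx =>
  ⟨(hf.summable x).subtype s, h.le_of_mem_closure hf (by rwa [closedSpan_subtype] at hx),
    hf.energy_le s x⟩

theorem FrameBoundsOn.lowerBound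
    (h : FrameBoundsOn 𝕜 (closedSpan 𝕜 (fun i : s => f i)) (fun i : s => f i) A B) :
    LowerBound 𝕜 f s A := fun x hx =>
  (h x (by rw [closedSpan_subtype]; exact Submodule.le_topologicalClosure _ hx)).2.1

theorem LowerBound.mono {A' : ℝ} (h : LowerBound 𝕜 f s A) (hA : A' ≤ A) : LowerBound 𝕜 f s A' :=
  fun x hx => (mul_le_mul_of_nonneg_right hA (by positivity)).trans (h x hx)

/-- The dual form of the lower frame inequality: the functional `⟨y, ·⟩` with `y` in the span is
controlled, on the whole space, by the energy. -/
theorem LowerBound.mul_norm_inner_sq_le [CompleteSpace H] (h : LowerBound 𝕜 f s A) (hA : 0 ≤ A)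
    (hf : IsBessel 𝕜 f B) {y : H} (hy : y ∈ Submodule.span 𝕜 (f '' s)) (z : H) :
    A * ‖inner 𝕜 y z‖ ^ 2 ≤ ‖y‖ ^ 2 * energy 𝕜 f s z := by
  set V := (Submodule.span 𝕜 (f '' s)).topologicalClosure
  have : CompleteSpace V := (Submodule.isClosed_topologicalClosure _).completeSpace_coe
  have key : ∀ v ∈ V, inner 𝕜 v (V.starProjection z) = inner 𝕜 v z := fun v hv => by
    rw [← Submodule.inner_starProjection_left_eq_right, Submodule.starProjection_eq_self_iff.2 hv]
  have h1 := h.le_of_mem_closure hf (V.starProjection_apply_mem z)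
  rw [energy_congr (g := f) (y := z) fun i hi => by
    rw [key _ (Submodule.le_topologicalClosure _ (Submodule.subset_span ⟨i, hi, rfl⟩))]] at h1
  rw [← key y (Submodule.le_topologicalClosure _ hy)]
  calc A * ‖inner 𝕜 y (V.starProjection z)‖ ^ 2
      ≤ A * (‖y‖ * ‖V.starProjection z‖) ^ 2 := by gcongr; exact norm_inner_le_norm _ _
    _ = ‖y‖ ^ 2 * (A * ‖V.starProjection z‖ ^ 2) := by ring
    _ ≤ _ := by gcongr

/-- It suffices to know the dual form of the lower frame inequality at vectors of the span. -/
theorem LowerBound.of_norm_inner_sq_le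
    (h : ∀ y ∈ Submodule.span 𝕜 (f '' s), ∀ z : H,
      A * ‖inner 𝕜 y z‖ ^ 2 ≤ ‖y‖ ^ 2 * energy 𝕜 f s z) : LowerBound 𝕜 f s A := by
  intro y hy
  rcases eq_or_ne y 0 with rfl | h0
  · simpa using energy_nonneg _
  have h1 := h y hy y
  rw [inner_self_eq_norm_sq_to_K, norm_pow, RCLike.norm_ofReal, abs_norm] at h1
  have h2 : 0 < ‖y‖ ^ 2 := by positivity
  exact le_of_mul_le_mul_left (by linarith) h2

/-- Cauchy–Schwarz for a finite linear combination. -/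
theorem norm_inner_sum_sq_le (F : Finset ι) (a : ι → 𝕜) (f : ι → H) (z : H) :
    ‖inner 𝕜 (∑ i ∈ F, a i • f i) z‖ ^ 2
      ≤ (∑ i ∈ F, ‖a i‖ ^ 2) * ∑ i ∈ F, ‖inner 𝕜 (f i) z‖ ^ 2 := by
  refine le_trans ?_ (Finset.sum_mul_sq_le_sq_mul_sq F (fun i => ‖a i‖) _)
  gcongr
  rw [sum_inner]
  refine (norm_sum_le _ _).trans (Finset.sum_le_sum fun i _ => ?_)
  rw [inner_smul_left, norm_mul, RCLike.norm_conj]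

theorem IsBessel.norm_sum_sq_le (hf : IsBessel 𝕜 f B) (F : Finset ι) (a : ι → 𝕜) :
    ‖∑ i ∈ F, a i • f i‖ ^ 2 ≤ B * ∑ i ∈ F, ‖a i‖ ^ 2 := by
  set y := ∑ i ∈ F, a i • f i with hy
  rcases eq_or_ne y 0 with h0 | h0
  · rw [h0, norm_zero]
    have h0 := mul_nonneg hf.nonneg (Finset.sum_nonneg fun i (_ : i ∈ F) => sq_nonneg ‖a i‖)
    simpa using h0
  have h1 := norm_inner_sum_sq_le F a f y
  rw [← hy, inner_self_eq_norm_sq_to_K, norm_pow, RCLike.norm_ofReal, abs_norm] at h1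
  have h2 : 0 < ‖y‖ ^ 2 := by positivity
  have h3 := mul_le_mul_of_nonneg_left (hf.sum_le F y)
    (Finset.sum_nonneg fun i (_ : i ∈ F) => sq_nonneg ‖a i‖)
  exact le_of_mul_le_mul_left (by linarith) h2

end

end FrameTheory

/-! ### The strong projection method from uniform lower bounds -/

namespace FrameTheory

section

variable {𝕜 H : Type*} [RCLike 𝕜] [NormedAddCommGroup H] [InnerProductSpace 𝕜 H]
  {f : ℕ → H} {A B : ℝ}

instance (f : ℕ → H) (n : ℕ) : FiniteDimensional 𝕜 (partialSpan 𝕜 f n) :=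
  FiniteDimensional.span_of_finite 𝕜 ((Set.finite_Iio n).image f)

theorem coe_partialFrameOperator (f : ℕ → H) (n : ℕ) (y : partialSpan 𝕜 f n) :
    (partialFrameOperator 𝕜 f n y : H)
      = ∑ i ∈ Finset.range n, (inner 𝕜 (f i) (y : H) : 𝕜) • f i := by
  rw [← Fin.sum_univ_eq_sum_range fun i => (inner 𝕜 (f i) (y : H) : 𝕜) • f i]
  simp [partialFrameOperator]

/-- The coefficients `⟨x, Sₙ⁻¹ fᵢ⟩` are the coefficients `⟨y, fᵢ⟩` of `y = Sₙ⁻¹ Pₙ x`, where `Pₙ` is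
the orthogonal projection onto `Hₙ`. -/
theorem exists_inner_partialDual_eq (f : ℕ → H) (n : ℕ) (x : H) :
    ∃ y ∈ partialSpan 𝕜 f n,
      ∑ i ∈ Finset.range n, (inner 𝕜 (f i) y : 𝕜) • f i = (partialSpan 𝕜 f n).starProjection x ∧
      ∀ i < n, (inner 𝕜 (partialDual 𝕜 f n i) x : 𝕜) = inner 𝕜 (f i) y := by
  set V := partialSpan 𝕜 f n
  obtain ⟨y, hy⟩ := (partialFrameOperator_bijective 𝕜 f n).2
    ⟨V.starProjection x, V.starProjection_apply_mem x⟩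
  have hy' := congrArg (Subtype.val) hy
  rw [coe_partialFrameOperator] at hy'
  refine ⟨y, y.2, hy', fun i hi => ?_⟩
  obtain ⟨u, hu⟩ := (partialFrameOperator_bijective 𝕜 f n).2 ⟨f i, mem_partialSpan 𝕜 f hi⟩
  have hd : partialDual 𝕜 f n i = u := by
    rw [partialDual, dif_pos hi, ← hu]
    exact congrArg Subtype.val
      ((LinearEquiv.ofBijective _ (partialFrameOperator_bijective 𝕜 f n)).symm_apply_apply u)
  have hu' := congrArg (Subtype.val) hu
  rw [coe_partialFrameOperator] at hu'
  have hp : (inner 𝕜 (u : H) (V.starProjection x) : 𝕜) = inner 𝕜 (u : H) x := by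
    rw [← Submodule.inner_starProjection_left_eq_right, Submodule.starProjection_eq_self_iff.2 u.2]
  rw [hd, ← hp]
  simp only at hu' hy'
  rw [← hu', ← hy', inner_sum, sum_inner]
  refine Finset.sum_congr rfl fun j _ => ?_
  rw [inner_smul_left, inner_smul_right, inner_conj_symm, mul_comm]

/-- Every vector of `Hₙ` is the combination of the `fᵢ` with coefficients `⟨x, Sₙ⁻¹ fᵢ⟩`. -/
theorem sum_inner_partialDual_smul (f : ℕ → H) (n : ℕ) {x : H} (hx : x ∈ partialSpan 𝕜 f n) :
    ∑ i ∈ Finset.range n, (inner 𝕜 (partialDual 𝕜 f n i) x : 𝕜) • f i = x := by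
  obtain ⟨y, -, h1, h2⟩ := exists_inner_partialDual_eq (𝕜 := 𝕜) f n x
  rw [Submodule.starProjection_eq_self_iff.2 hx] at h1
  rw [← h1]
  refine Finset.sum_congr rfl fun i hi => ?_
  rw [h1, h2 i (Finset.mem_range.1 hi)]

/-- Energy at `w ∈ Hₙ` is dominated by `‖Sₙ w‖²`, with constant the inverse of the lower bound. -/
theorem LowerBound.sum_le (h : LowerBound 𝕜 f (Set.Iio n) A) (hA : 0 < A) {w : H}
    (hw : w ∈ partialSpan 𝕜 f n) :
    ∑ i ∈ Finset.range n, ‖(inner 𝕜 (f i) w : 𝕜)‖ ^ 2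
      ≤ A⁻¹ * ‖∑ i ∈ Finset.range n, (inner 𝕜 (f i) w : 𝕜) • f i‖ ^ 2 := by
  have h1 := h w hw
  rw [← Finset.coe_range, energy_coe] at h1
  set E := ∑ i ∈ Finset.range n, ‖(inner 𝕜 (f i) w : 𝕜)‖ ^ 2 with hE
  set v := ∑ i ∈ Finset.range n, (inner 𝕜 (f i) w : 𝕜) • f i with hv
  have h2 : inner 𝕜 v w = (E : 𝕜) := by
    rw [hv, hE, sum_inner]
    push_cast
    refine Finset.sum_congr rfl fun i _ => ?_
    rw [inner_smul_left, RCLike.conj_mul]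
  have hE0 : 0 ≤ E := Finset.sum_nonneg fun _ _ => by positivity
  have h3 : E ≤ ‖v‖ * ‖w‖ := by
    have := norm_inner_le_norm (𝕜 := 𝕜) v w
    rwa [h2, RCLike.norm_ofReal, abs_of_nonneg hE0] at this
  rcases hE0.eq_or_lt with h0 | h0
  · rw [← h0]; positivity
  rw [inv_mul_eq_div, le_div_iff₀ hA]
  refine le_of_mul_le_mul_left ?_ h0
  calc E * (E * A) = E ^ 2 * A := by ring
    _ ≤ (‖v‖ * ‖w‖) ^ 2 * A := by gcongr
    _ = ‖v‖ ^ 2 * (A * ‖w‖ ^ 2) := by ring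
    _ ≤ ‖v‖ ^ 2 * E := by gcongr
    _ = _ := mul_comm _ _

theorem StrongProjectionMethod.projectionMethod (h : StrongProjectionMethod 𝕜 f) :
    ProjectionMethod 𝕜 f := by
  intro x i
  have h0 := (h x).2
  rw [tendsto_iff_norm_sub_tendsto_zero]
  have h1 : Tendsto (fun n => ‖(inner 𝕜 (partialDual 𝕜 f n i) x : 𝕜)
      - inner 𝕜 (dualFrame 𝕜 f i) x‖ ^ 2) atTop (𝓝 0) := by
    refine tendsto_of_tendsto_of_tendsto_of_le_of_le' tendsto_const_nhds h0
      (.of_forall fun n => by positivity) ?_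
    filter_upwards [eventually_gt_atTop i] with n hn
    refine le_trans ?_ (le_add_of_nonneg_right (tsum_nonneg fun _ => by positivity))
    exact Finset.single_le_sum (f := fun i => ‖(inner 𝕜 (partialDual 𝕜 f n i) x : 𝕜)
      - inner 𝕜 (dualFrame 𝕜 f i) x‖ ^ 2) (fun _ _ => by positivity) (Finset.mem_range.2 hn)
  have h2 := h1.sqrt
  simpa [Real.sqrt_sq] using h2

variable [CompleteSpace H]

theorem IsBessel.frameOperator_eq (hf : IsBessel 𝕜 f B) : frameOperator 𝕜 f = hf.frameOp :=
  funext fun x => (hf.hasSum_frameOp x).tsum_eq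

/-- If `S y = x` then `⟨x, S⁻¹ fᵢ⟩ = ⟨y, fᵢ⟩`. -/
theorem IsFrame.exists_inner_dualFrame_eq (h : IsFrame 𝕜 f) (x : H) :
    ∃ y, HasSum (fun i => (inner 𝕜 (f i) y : 𝕜) • f i) x ∧
      ∀ i, (inner 𝕜 (dualFrame 𝕜 f i) x : 𝕜) = inner 𝕜 (f i) y := by
  obtain ⟨B, hB⟩ := h.exists_isBessel
  obtain ⟨A, _, hA, -, hA'⟩ := h
  have hbij := hB.frameOp_bijective hA fun x => (hA' x trivial).2.1
  obtain ⟨y, rfl⟩ := hbij.2 x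
  refine ⟨y, hB.hasSum_frameOp y, fun i => ?_⟩
  rw [← hB.inner_frameOp, dualFrame, hB.frameOperator_eq, Function.rightInverse_invFun hbij.2]

/-- The strong projection method works as soon as the initial segments of the sequence are frames
for their spans with a common lower bound. -/
theorem strongProjectionMethod_of_lowerBound (hf : IsFrame 𝕜 f) (hA : 0 < A)
    (h : ∀ᶠ n in atTop, LowerBound 𝕜 f (Set.Iio n) A) : StrongProjectionMethod 𝕜 f := by
  intro x
  obtain ⟨B, hB⟩ := hf.exists_isBessel
  obtain ⟨y, hy, hyd⟩ := hf.exists_inner_dualFrame_eq x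
  simp only [hyd]
  refine ⟨hB.summable y, ?_⟩
  have ht : Tendsto (fun n : ℕ => ∑' j : ℕ, ‖(inner 𝕜 (f (n + j)) y : 𝕜)‖ ^ 2) atTop (𝓝 0) := by
    simpa only [add_comm] using tendsto_sum_nat_add fun i => ‖(inner 𝕜 (f i) y : 𝕜)‖ ^ 2
  have hs : Tendsto (fun n : ℕ => A⁻¹ *
      ‖x - ∑ i ∈ Finset.range n, (inner 𝕜 (f i) y : 𝕜) • f i‖ ^ 2) atTop (𝓝 0) := by
    have := ((hy.tendsto_sum_nat.const_sub x).norm.pow 2).const_mul A⁻¹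
    simpa using this
  have hd : Tendsto (fun n : ℕ => ∑ i ∈ Finset.range n,
      ‖(inner 𝕜 (partialDual 𝕜 f n i) x : 𝕜) - inner 𝕜 (f i) y‖ ^ 2) atTop (𝓝 0) := by
    refine tendsto_of_tendsto_of_tendsto_of_le_of_le' tendsto_const_nhds hs
      (.of_forall fun n => Finset.sum_nonneg fun _ _ => by positivity) ?_
    filter_upwards [h] with n hn
    obtain ⟨u, hu, hu1, hu2⟩ := exists_inner_partialDual_eq (𝕜 := 𝕜) f n x
    set V := partialSpan 𝕜 f n
    have hq : ∀ i ∈ Finset.range n,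
        (inner 𝕜 (f i) (V.starProjection y) : 𝕜) = inner 𝕜 (f i) y := fun i hi => by
      rw [← Submodule.inner_starProjection_left_eq_right, Submodule.starProjection_eq_self_iff.2
        (mem_partialSpan 𝕜 f (Finset.mem_range.1 hi))]
    have hw : u - V.starProjection y ∈ V := sub_mem hu (V.starProjection_apply_mem y)
    have e1 : ∀ i ∈ Finset.range n, (inner 𝕜 (f i) (u - V.starProjection y) : 𝕜)
        = inner 𝕜 (partialDual 𝕜 f n i) x - inner 𝕜 (f i) y := fun i hi => by
      rw [inner_sub_right, hq i hi, hu2 i (Finset.mem_range.1 hi)]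
    -- `Sₙ (u - Pₙ y) = Pₙ x - Sₙ y = Pₙ (x - Sₙ y)`, since `Sₙ y` lies in `Hₙ`
    have e2 : ∑ i ∈ Finset.range n, (inner 𝕜 (f i) (u - V.starProjection y) : 𝕜) • f i
        = V.starProjection (x - ∑ i ∈ Finset.range n, (inner 𝕜 (f i) y : 𝕜) • f i) := by
      have hm : ∑ i ∈ Finset.range n, (inner 𝕜 (f i) y : 𝕜) • f i ∈ V :=
        sum_mem fun i hi => V.smul_mem _ (mem_partialSpan 𝕜 f (Finset.mem_range.1 hi))
      rw [map_sub, Submodule.starProjection_eq_self_iff.2 hm, ← hu1, ← Finset.sum_sub_distrib]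
      refine Finset.sum_congr rfl fun i hi => ?_
      rw [inner_sub_right, hq i hi, sub_smul]
    have h3 := hn.sum_le hA hw
    rw [e2, Finset.sum_congr rfl fun i hi => by rw [e1 i hi]] at h3
    refine h3.trans ?_
    gcongr
    exact V.norm_starProjection_apply_le _
  simpa using hd.add ht

end

end FrameTheory

/-! ### Lower Riesz bounds and perturbation of lower frame bounds -/

namespace FrameTheory

section

variable {𝕜 H ι : Type*} [RCLike 𝕜] [NormedAddCommGroup H] [InnerProductSpace 𝕜 H]
  {f : ι → H} {A B : ℝ} {s : Set ι}

theorem mem_span_image_iff_exists_finset {x : H} :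
    x ∈ Submodule.span 𝕜 (f '' s) ↔
      ∃ F : Finset ι, ↑F ⊆ s ∧ ∃ a : ι → 𝕜, ∑ i ∈ F, a i • f i = x := by
  constructor
  · intro h
    obtain ⟨l, hl, rfl⟩ := (Finsupp.mem_span_image_iff_linearCombination 𝕜).1 h
    exact ⟨l.support, hl, l, rfl⟩
  · rintro ⟨F, hF, a, rfl⟩
    exact sum_mem fun i hi => Submodule.smul_mem _ _ (Submodule.subset_span ⟨i, hF hi, rfl⟩)

theorem exists_finset_mem_span {x : H} (h : x ∈ Submodule.span 𝕜 (f '' s)) :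
    ∃ F : Finset ι, ↑F ⊆ s ∧ x ∈ Submodule.span 𝕜 (f '' F) := by
  obtain ⟨F, hF, a, rfl⟩ := mem_span_image_iff_exists_finset.1 h
  exact ⟨F, hF, mem_span_image_iff_exists_finset.2 ⟨F, subset_rfl, a, rfl⟩⟩

variable (𝕜) in
/-- The lower Riesz inequality `c ∑ |aᵢ|² ≤ ‖∑ aᵢ fᵢ‖²` for finite linear combinations of the
subfamily indexed by `s`. -/
def RieszLowerBound (f : ι → H) (s : Set ι) (c : ℝ) : Prop :=
  ∀ (F : Finset ι) (a : ι → 𝕜), ↑F ⊆ s → c * ∑ i ∈ F, ‖a i‖ ^ 2 ≤ ‖∑ i ∈ F, a i • f i‖ ^ 2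

theorem IsRieszBasis.exists_rieszLowerBound {g : ι → H} (hg : IsRieszBasis 𝕜 g) :
    ∃ c, 0 < c ∧ RieszLowerBound 𝕜 g Set.univ c := by
  classical
  obtain ⟨-, c, C, hc, -, h⟩ := hg
  refine ⟨c, hc, fun F a _ => ?_⟩
  have h1 := (h (Finsupp.indicator F fun i _ => a i)).1
  have hs := Finsupp.support_indicator_subset F (fun i _ => a i)
  rw [Finset.sum_subset hs fun i _ hi => by rw [Finsupp.notMem_support_iff.1 hi]; simp,
    Finset.sum_subset hs fun i _ hi => by rw [Finsupp.notMem_support_iff.1 hi]; simp,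
    Finset.sum_congr rfl fun i hi => by rw [Finsupp.indicator_of_mem hi],
    Finset.sum_congr (g := fun i => a i • g i) rfl fun i hi => by
      rw [Finsupp.indicator_of_mem hi]] at h1
  exact h1

theorem RieszLowerBound.isRieszBasis {c : ℝ} (h : RieszLowerBound 𝕜 f s c) (hc : 0 < c)
    (hf : IsBessel 𝕜 f B) (hs : (Submodule.span 𝕜 (f '' s)).topologicalClosure = ⊤) :
    IsRieszBasis 𝕜 (fun i : s => f i) := by
  refine ⟨(closedSpan_subtype f s).trans hs, c, B + 1, hc, by linarith [hf.nonneg], fun a => ?_⟩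
  set F : Finset ι := a.support.map ⟨Subtype.val, Subtype.val_injective⟩ with hF
  set b : ι → 𝕜 := Function.extend Subtype.val a 0
  have hb : ∀ i : s, b i = a i := fun i => Subtype.val_injective.extend_apply a 0 i
  have e1 : ∑ i ∈ F, ‖b i‖ ^ 2 = ∑ i ∈ a.support, ‖a i‖ ^ 2 := by simp [hF, hb]
  have e2 : ∑ i ∈ F, b i • f i = ∑ i ∈ a.support, a i • f i := by simp [hF, hb]
  rw [← e1, ← e2]
  have h0 : 0 ≤ ∑ i ∈ F, ‖b i‖ ^ 2 := Finset.sum_nonneg fun _ _ => by positivity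
  refine ⟨h F b (by simp [hF]), (hf.norm_sum_sq_le F b).trans ?_⟩
  nlinarith

/-- Expansions with respect to a family with a lower Riesz bound are unique. -/
theorem RieszLowerBound.eq_of_hasSum {c : ℝ} (h : RieszLowerBound 𝕜 f Set.univ c) (hc : 0 < c)
    {a b : ι → 𝕜} {x : H} (ha : HasSum (fun i => a i • f i) x)
    (hb : HasSum (fun i => b i • f i) x) : a = b := by
  have hd := ha.sub hb
  simp only [← sub_smul, sub_self] at hd
  funext i
  have h1 : Tendsto (fun F : Finset ι => ‖∑ j ∈ F, (a j - b j) • f j‖ ^ 2) atTop (𝓝 0) := by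
    simpa using (hd.norm.pow 2)
  have h2 : c * ‖a i - b i‖ ^ 2 ≤ 0 := by
    refine ge_of_tendsto h1 ?_
    filter_upwards [eventually_ge_atTop {i}] with F hF
    refine le_trans ?_ (h F (fun j => a j - b j) (Set.subset_univ _))
    exact mul_le_mul_of_nonneg_left (Finset.single_le_sum (f := fun j => ‖a j - b j‖ ^ 2)
      (fun _ _ => by positivity) (hF (Finset.mem_singleton_self i))) hc.le
  have h3 : ‖a i - b i‖ ^ 2 ≤ 0 := by
    by_contra h4
    push Not at h4
    nlinarith [mul_pos hc h4]
  have h4 : ‖a i - b i‖ = 0 := pow_eq_zero_iff two_ne_zero |>.1 (le_antisymm h3 (by positivity))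
  exact sub_eq_zero.1 (norm_eq_zero.1 h4)

theorem HasInfiniteSupport.notMem_span {g : ι → H} (hg : IsRieszBasis 𝕜 g) {x : H}
    (hx : HasInfiniteSupport 𝕜 g x) : x ∉ Submodule.span 𝕜 (Set.range g) := by
  classical
  intro hm
  obtain ⟨a, ha, hinf⟩ := hx
  obtain ⟨c, hc, h⟩ := hg.exists_rieszLowerBound
  rw [← Set.image_univ] at hm
  obtain ⟨F, -, b, rfl⟩ := mem_span_image_iff_exists_finset.1 hm
  have hb : HasSum (fun i => (if i ∈ F then b i else 0) • g i) (∑ i ∈ F, b i • g i) := by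
    have := hasSum_sum_of_ne_finset_zero (f := fun i => (if i ∈ F then b i else 0) • g i) (s := F)
      (L := .unconditional ι) fun i hi => by simp [hi]
    convert! this using 1
    exact Finset.sum_congr rfl fun i hi => by simp [hi]
  have he := h.eq_of_hasSum hc ha hb
  refine hinf (F.finite_toSet.subset fun i hi => ?_)
  by_contra hn
  simp only [Finset.mem_coe] at hn
  simp [he, hn] at hi

theorem IsRieszFrame.exists_lowerBound {w : ι → H} (hw : IsRieszFrame 𝕜 w) :
    ∃ A, 0 < A ∧ ∀ s : Set ι, LowerBound 𝕜 w s A := by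
  obtain ⟨-, A, B, hA, -, h⟩ := hw
  exact ⟨A, hA, fun s => (h s).lowerBound⟩

/-- If all subfamilies of `w` have a common lower bound, and `S` indexes a total subfamily, then
every member of `w` is a finite combination of that subfamily: for a finite set `F` of indices,
the distance `d` of `w i` to the span of `(w j)_{j ∈ F}` is either `0` or at least `√A`. -/
theorem mem_span_of_lowerBound {w : ι → H} (hA : 0 < A)
    (h : ∀ s : Set ι, LowerBound 𝕜 w s A) {S : Set ι}
    (hS : (Submodule.span 𝕜 (w '' S)).topologicalClosure = ⊤) (i : ι) :
    w i ∈ Submodule.span 𝕜 (w '' S) := by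
  classical
  have hi : w i ∈ closure (Submodule.span 𝕜 (w '' S) : Set H) := by
    rw [← Submodule.topologicalClosure_coe, hS]; trivial
  obtain ⟨v, hv, hd⟩ := Metric.mem_closure_iff.1 hi √A (by positivity)
  obtain ⟨F, hF, hvF⟩ := exists_finset_mem_span hv
  set V := Submodule.span 𝕜 (w '' (F : Set ι)) with hV
  have : FiniteDimensional 𝕜 V :=
    FiniteDimensional.span_of_finite 𝕜 (F.finite_toSet.image w)
  set x := w i - V.starProjection (w i) with hx
  have hle : V ≤ Submodule.span 𝕜 (w '' ((insert i F : Finset ι) : Set ι)) :=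
    Submodule.span_mono (Set.image_mono (by simp))
  have hxm : x ∈ Submodule.span 𝕜 (w '' ((insert i F : Finset ι) : Set ι)) :=
    sub_mem (Submodule.subset_span ⟨i, by simp, rfl⟩) (hle (V.starProjection_apply_mem _))
  have hort : ∀ u ∈ V, (inner 𝕜 u x : 𝕜) = 0 := fun u hu =>
    (Submodule.mem_orthogonal V x).1 (V.sub_starProjection_mem_orthogonal _) u hu
  have hix : (inner 𝕜 (w i) x : 𝕜) = inner 𝕜 x x := by
    conv_rhs => rw [hx, inner_sub_left, ← hx, hort _ (V.starProjection_apply_mem _), sub_zero]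
  have h1 := h _ x hxm
  rw [energy_coe, Finset.sum_eq_single_of_mem i (Finset.mem_insert_self _ _) fun j hj hji => by
    rw [hort _ (Submodule.subset_span ⟨j, by simpa [hji] using hj, rfl⟩)]; simp,
    hix, inner_self_eq_norm_sq_to_K, norm_pow, RCLike.norm_ofReal, abs_norm] at h1
  have h2 : ‖x‖ ≤ ‖w i - v‖ := by
    rw [hx, V.starProjection_minimal]
    exact ciInf_le ⟨0, by rintro _ ⟨y, rfl⟩; positivity⟩ (⟨v, hvF⟩ : V)
  rw [dist_eq_norm] at hd
  have h3 : ‖x‖ ^ 2 < A := by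
    rw [← Real.sq_sqrt hA.le]
    exact pow_lt_pow_left₀ (h2.trans_lt hd) (norm_nonneg _) two_ne_zero
  have h4 : x = 0 := by
    by_contra h0
    have : 0 < ‖x‖ ^ 2 := by positivity
    nlinarith
  rw [sub_eq_zero.1 h4]
  exact Submodule.span_mono (Set.image_mono hF) (V.starProjection_apply_mem _)

/-- A lower frame bound survives a square summable perturbation by vectors in the span of
members that are left unchanged. -/
theorem LowerBound.exists_of_perturbation [CompleteSpace H] {w : ι → H} {B' a : ℝ} {M : Set ι}
    (hf : IsBessel 𝕜 f B) (hw : IsBessel 𝕜 w B') (hA : 0 < A) (hwA : ∀ s, LowerBound 𝕜 w s A)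
    (ha : 0 < a) (hM : LowerBound 𝕜 f M a) (hMw : ∀ i ∈ M, w i = f i)
    (hd : ∀ i, f i - w i ∈ Submodule.span 𝕜 (f '' M)) (hsum : Summable fun i => ‖f i - w i‖ ^ 2) :
    ∃ A', 0 < A' ∧ ∀ s, M ⊆ s → LowerBound 𝕜 f s A' := by
  set D := ∑' i, ‖f i - w i‖ ^ 2
  have hD : 0 ≤ D := tsum_nonneg fun _ => by positivity
  set C := 2 + 2 * (a⁻¹ * D) with hC
  have hCpos : 0 < C := by positivity
  refine ⟨A * C⁻¹, by positivity, fun s hs => .of_norm_inner_sq_le fun y hy z => ?_⟩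
  have hspan : Submodule.span 𝕜 (f '' s) ≤ Submodule.span 𝕜 (w '' s) := by
    refine Submodule.span_le.2 ?_
    rintro _ ⟨i, hi, rfl⟩
    have h1 : f i - w i ∈ Submodule.span 𝕜 (w '' s) := by
      have h2 := hd i
      rw [← Set.image_congr hMw] at h2
      exact Submodule.span_mono (Set.image_mono hs) h2
    have h2 : w i ∈ Submodule.span 𝕜 (w '' s) := Submodule.subset_span ⟨i, hi, rfl⟩
    simpa using add_mem h1 h2
  have h1 := (hwA s).mul_norm_inner_sq_le hA.le hw (hspan hy) z
  have hpt : ∀ i, ‖(inner 𝕜 (w i) z : 𝕜)‖ ^ 2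
      ≤ 2 * ‖(inner 𝕜 (f i) z : 𝕜)‖ ^ 2 + 2 * (a⁻¹ * energy 𝕜 f M z) * ‖f i - w i‖ ^ 2 := by
    intro i
    have h2 := hM.mul_norm_inner_sq_le ha.le hf (hd i) z
    have h3 : ‖(inner 𝕜 (f i - w i) z : 𝕜)‖ ^ 2 ≤ a⁻¹ * energy 𝕜 f M z * ‖f i - w i‖ ^ 2 := by
      rw [mul_assoc, inv_mul_eq_div, le_div_iff₀ ha]
      linarith
    have h4 : ‖(inner 𝕜 (w i) z : 𝕜)‖ ≤ ‖(inner 𝕜 (f i) z : 𝕜)‖ + ‖(inner 𝕜 (f i - w i) z : 𝕜)‖ := by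
      have : (inner 𝕜 (w i) z : 𝕜) = inner 𝕜 (f i) z - inner 𝕜 (f i - w i) z := by
        rw [inner_sub_left]; ring
      rw [this]
      exact norm_sub_le _ _
    calc ‖(inner 𝕜 (w i) z : 𝕜)‖ ^ 2
        ≤ (‖(inner 𝕜 (f i) z : 𝕜)‖ + ‖(inner 𝕜 (f i - w i) z : 𝕜)‖) ^ 2 := by gcongr
      _ ≤ 2 * (‖(inner 𝕜 (f i) z : 𝕜)‖ ^ 2 + ‖(inner 𝕜 (f i - w i) z : 𝕜)‖ ^ 2) := add_sq_le
      _ ≤ _ := by linarith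
  have h2 : energy 𝕜 w s z ≤ C * energy 𝕜 f s z := by
    have hsf : Summable fun i : s => ‖(inner 𝕜 (f i) z : 𝕜)‖ ^ 2 := (hf.summable z).subtype s
    have hsd : Summable fun i : s => ‖f i - w i‖ ^ 2 := hsum.subtype s
    have e0 : 0 ≤ energy 𝕜 f M z := energy_nonneg z
    calc energy 𝕜 w s z ≤ ∑' i : s, (2 * ‖(inner 𝕜 (f i) z : 𝕜)‖ ^ 2
          + 2 * (a⁻¹ * energy 𝕜 f M z) * ‖f i - w i‖ ^ 2) :=
          Summable.tsum_le_tsum (fun i => hpt i) ((hw.summable z).subtype s)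
            ((hsf.mul_left _).add (hsd.mul_left _))
      _ = 2 * energy 𝕜 f s z + 2 * (a⁻¹ * energy 𝕜 f M z) * ∑' i : s, ‖f i - w i‖ ^ 2 := by
          rw [Summable.tsum_add (hsf.mul_left _) (hsd.mul_left _), tsum_mul_left, tsum_mul_left]
          rfl
      _ ≤ 2 * energy 𝕜 f s z + 2 * (a⁻¹ * energy 𝕜 f s z) * D := by
          have e1 := energy_nonneg (𝕜 := 𝕜) (f := f) (s := s) z
          gcongr
          · exact hf.energy_mono hs z
          · exact hsum.tsum_subtype_le _ s fun _ => by positivity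
      _ = C * energy 𝕜 f s z := by rw [hC]; ring
  rw [mul_right_comm, ← div_eq_mul_inv, div_le_iff₀ hCpos]
  calc A * ‖(inner 𝕜 y z : 𝕜)‖ ^ 2 ≤ ‖y‖ ^ 2 * energy 𝕜 w s z := h1
    _ ≤ ‖y‖ ^ 2 * (C * energy 𝕜 f s z) := by gcongr
    _ = _ := by ring

end

end FrameTheory

/-! ### Decompositions and the projection methods -/

namespace FrameTheory

section

variable {𝕜 H : Type*} [RCLike 𝕜] [NormedAddCommGroup H] [InnerProductSpace 𝕜 H]
  {f : ℕ → H}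

namespace SubframeDecomposition

/-- The index in the original sequence of a member of the Riesz frame `(g, h¹)`. -/
def index (D : SubframeDecomposition 𝕜 f) : D.I ⊕ D.Γ → ℕ := Sum.elim (↑) (↑)

theorem index_injective (D : SubframeDecomposition 𝕜 f) : Function.Injective D.index := by
  refine Subtype.val_injective.sumElim Subtype.val_injective fun a b h => ?_
  exact Set.disjoint_left.1 D.disjoint_I_Γ a.2 (h ▸ b.2)

theorem range_index (D : SubframeDecomposition 𝕜 f) :
    Set.range D.index = (D.K : Set ℕ)ᶜ := by
  rw [index, Set.Sum.elim_range, Subtype.range_coe, Subtype.range_coe]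
  refine Set.Subset.antisymm ?_ fun i hi => ?_
  · rw [Set.subset_compl_iff_disjoint_right]
    exact Set.disjoint_union_left.2 ⟨D.disjoint_I_K, D.disjoint_Γ_K⟩
  · have h : i ∈ D.I ∪ D.Γ ∪ (D.K : Set ℕ) := D.union_eq ▸ Set.mem_univ i
    exact h.resolve_right hi

/-- The members of the families `g` and `h` are finite combinations of the Riesz basis `g`. -/
theorem mem_span_of_notMem (D : SubframeDecomposition 𝕜 f) {i : ℕ} (hi : i ∉ D.K) :
    f i ∈ Submodule.span 𝕜 (f '' D.I) := by
  have hi' : i ∈ Set.range D.index := by rw [range_index]; exact hi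
  obtain ⟨q | q, rfl⟩ := hi'
  · exact Submodule.subset_span ⟨q, q.2, rfl⟩
  obtain ⟨A, hA, h⟩ := D.rieszFrame.exists_lowerBound
  have him : Sum.elim (fun i : D.I => f i) D.h₁ '' Set.range Sum.inl = f '' D.I := by
    rw [← Set.range_comp, Set.image_eq_range]; rfl
  have h1 := mem_span_of_lowerBound hA h (S := Set.range Sum.inl)
    (by rw [him, ← closedSpan_subtype]; exact D.rieszBasis.1) (Sum.inr q)
  rw [him] at h1
  change f q ∈ _
  rw [D.add_eq q]
  exact add_mem h1 (Submodule.span_mono (Set.image_mono D.M_subset) (D.h₂_mem q))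

/-- Without infinitely supported vectors, all subfamilies that contain the finite subfamily
indexed by `M` have a common lower frame bound. -/
theorem exists_lowerBound [CompleteSpace H] (D : SubframeDecomposition 𝕜 f) (hK : D.K = ∅)
    (hf : IsFrame 𝕜 f) (hsub : HasSubframeProperty 𝕜 f) :
    ∃ A, 0 < A ∧ ∀ s : Set ℕ, ↑D.M ⊆ s → LowerBound 𝕜 f s A := by
  obtain ⟨B, hB⟩ := hf.exists_isBessel
  obtain ⟨B', hB'⟩ := D.rieszFrame.1.exists_isBessel
  obtain ⟨A, hA, hR⟩ := D.rieszFrame.exists_lowerBound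
  obtain ⟨a, b, ha, -, hM⟩ := hsub D.M
  have hM := hM.lowerBound
  have hsurj : Function.Surjective D.index := by
    rw [← Set.range_eq_univ, range_index, hK]; simp
  have himg : ∀ s : Set ℕ, D.index '' (D.index ⁻¹' s) = s := fun s =>
    Set.image_preimage_eq s hsurj
  have hdiff : ∀ q : D.I ⊕ D.Γ, (f ∘ D.index) q - Sum.elim (fun i : D.I => f i) D.h₁ q
      = Sum.elim (fun _ : D.I => (0 : H)) D.h₂ q := by
    rintro (q | q)
    · simp [index]
    · simp [index, D.add_eq q]
  obtain ⟨A', hA', h⟩ := LowerBound.exists_of_perturbation (f := f ∘ D.index)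
    (M := D.index ⁻¹' D.M) (hB.comp D.index_injective) hB' hA hR ha
    (by rwa [lowerBound_comp_iff _ D.index_injective, himg])
    (by
      rintro (q | q) hq
      · rfl
      · exact absurd q.2 (Set.disjoint_left.1 D.disjoint_I_Γ (D.M_subset hq)))
    (by
      intro q
      rw [hdiff, Set.image_comp, himg]
      rcases q with q | q
      · exact zero_mem _
      · exact D.h₂_mem q)
    (by
      simp only [hdiff]
      rw [← Sum.inr_injective.summable_iff]
      · exact D.summable_h₂
      · rintro (q | q) hq
        · simp
        · exact absurd ⟨q, rfl⟩ hq)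
  refine ⟨A', hA', fun s hs => ?_⟩
  have := h (D.index ⁻¹' s) (Set.preimage_mono hs)
  rwa [lowerBound_comp_iff _ D.index_injective, himg] at this

end SubframeDecomposition

theorem IsFrame.comp_perm (hf : IsFrame 𝕜 f) (σ : Equiv.Perm ℕ) : IsFrame 𝕜 (f ∘ σ) := by
  obtain ⟨A, B, hA, hB, h⟩ := hf
  refine ⟨A, B, hA, hB, fun x hx => ?_⟩
  have e : ∑' i, ‖(inner 𝕜 ((f ∘ σ) i) x : 𝕜)‖ ^ 2 = ∑' i, ‖(inner 𝕜 (f i) x : 𝕜)‖ ^ 2 :=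
    σ.tsum_eq fun i => ‖(inner 𝕜 (f i) x : 𝕜)‖ ^ 2
  rw [e]
  exact ⟨(h x hx).1.comp_injective σ.injective, (h x hx).2⟩

/-- Every finite set of indices lies in an initial segment of a rearranged sequence. -/
theorem eventually_subset_image_Iio (σ : Equiv.Perm ℕ) (F : Finset ℕ) :
    ∀ᶠ n in atTop, (F : Set ℕ) ⊆ σ '' Set.Iio n := by
  filter_upwards [eventually_gt_atTop (F.sup σ.symm)] with n hn i hi
  exact ⟨σ.symm i, (Finset.le_sup (f := σ.symm) hi).trans_lt hn, σ.apply_symm_apply i⟩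

theorem SubframeDecomposition.strongProjectionMethod [CompleteSpace H]
    (D : SubframeDecomposition 𝕜 f) (hK : D.K = ∅) (hf : IsFrame 𝕜 f)
    (hsub : HasSubframeProperty 𝕜 f) (σ : Equiv.Perm ℕ) :
    StrongProjectionMethod 𝕜 (f ∘ σ) := by
  obtain ⟨A, hA, h⟩ := D.exists_lowerBound hK hf hsub
  refine strongProjectionMethod_of_lowerBound (hf.comp_perm σ) hA ?_
  filter_upwards [eventually_subset_image_Iio σ D.M] with n hn
  exact (lowerBound_comp_iff σ σ.injective _).2 (h _ hn)

/-- If the projection method works, the vectors `Sₙ⁻¹ fᵢ` are bounded in `n`. -/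
theorem ProjectionMethod.exists_norm_partialDual_le [CompleteSpace H]
    (h : ProjectionMethod 𝕜 f) (i : ℕ) : ∃ C, ∀ n, ‖partialDual 𝕜 f n i‖ ≤ C := by
  obtain ⟨C, hC⟩ := banach_steinhaus (g := fun n => innerSL 𝕜 (partialDual 𝕜 f n i)) fun x => by
    obtain ⟨C, hC⟩ := (h x i).norm.bddAbove_range
    exact ⟨C, fun n => hC ⟨n, rfl⟩⟩
  exact ⟨C, fun n => by simpa using hC n⟩

/-- If the projection method works for some order, then finitely many vectors `(f i)_{i ∈ K}` lie
in the algebraic span of the others, provided that these are total: the coefficients at `K` of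
`f k - v`, where `v` in the span `V` of the others is close to `f k`, are small, whereas the
coefficient families `b` with `f k - ∑_{i ∈ K} b i • f i ∈ V` form a closed affine subspace. -/
theorem ProjectionMethod.mem_span_compl [CompleteSpace H] {σ : Equiv.Perm ℕ}
    (h : ProjectionMethod 𝕜 (f ∘ σ)) (K : Finset ℕ)
    (hV : (Submodule.span 𝕜 (f '' (K : Set ℕ)ᶜ)).topologicalClosure = ⊤) {k : ℕ} (hk : k ∈ K) :
    f k ∈ Submodule.span 𝕜 (f '' (K : Set ℕ)ᶜ) := by
  classical
  set V := Submodule.span 𝕜 (f '' (K : Set ℕ)ᶜ) with hVdef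
  let T : (K → 𝕜) →ₗ[𝕜] H := Fintype.linearCombination 𝕜 (fun j : K => f j)
  have hT : ∀ b : K → 𝕜, T b = ∑ j : K, b j • f j := fun b => Fintype.linearCombination_apply _ _ _
  have hcl : IsClosed (V.comap T : Set (K → 𝕜)) := Submodule.closed_of_finiteDimensional _
  choose C hC using fun j : K => h.exists_norm_partialDual_le (σ.symm j)
  have key : ∀ m : ℕ, ∃ b : K → 𝕜, (∀ j, ‖b j‖ ≤ C j * (1 / ((m : ℝ) + 1))) ∧
      f k - T b ∈ V := by
    intro m
    have hcm : f k ∈ closure (V : Set H) := by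
      rw [← Submodule.topologicalClosure_coe, hV]; trivial
    obtain ⟨v, hv, hd⟩ := Metric.mem_closure_iff.1 hcm (1 / ((m : ℝ) + 1)) (by positivity)
    obtain ⟨F, hF, hvF⟩ := exists_finset_mem_span hv
    obtain ⟨n, hnF, hnK⟩ := ((eventually_subset_image_Iio σ F).and
      (eventually_subset_image_Iio σ K)).exists
    have hx : f k - v ∈ partialSpan 𝕜 (f ∘ σ) n := by
      rw [partialSpan, Set.image_comp]
      exact sub_mem (Submodule.subset_span ⟨k, hnK hk, rfl⟩)
        (Submodule.span_mono (Set.image_mono hnF) hvF)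
    have hsum := sum_inner_partialDual_smul (f ∘ σ) n hx
    set b : ℕ → 𝕜 := fun i => inner 𝕜 (partialDual 𝕜 (f ∘ σ) n i) (f k - v)
    refine ⟨fun j => b (σ.symm j), fun j => ?_, ?_⟩
    · refine (norm_inner_le_norm _ _).trans ?_
      rw [← dist_eq_norm]
      exact mul_le_mul (hC j n) hd.le dist_nonneg ((norm_nonneg _).trans (hC j n))
    -- split the expansion of `f k - v` into the terms in `K` and the others
    have hsplit : ∑ i ∈ Finset.range n with σ i ∈ K, b i • f (σ i) = T fun j => b (σ.symm j) := by
      rw [hT]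
      refine Finset.sum_bij' (fun i hi => (⟨σ i, (Finset.mem_filter.1 hi).2⟩ : K))
        (fun j _ => σ.symm j) (by simp) (fun j _ => ?_) (by simp) (by simp) (by simp)
      obtain ⟨i, hi, hij⟩ := hnK j.2
      have hji : σ.symm j = i := by rw [← hij, σ.symm_apply_apply]
      simpa [hji, hij] using hi
    rw [← Finset.sum_filter_add_sum_filter_not (Finset.range n) (fun i => σ i ∈ K)] at hsum
    simp only [Function.comp_apply] at hsum
    rw [hsplit] at hsum
    have h2 : ∑ i ∈ Finset.range n with σ i ∉ K, b i • f (σ i) ∈ V :=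
      sum_mem fun i hi => V.smul_mem _ (Submodule.subset_span
        ⟨σ i, by simpa using (Finset.mem_filter.1 hi).2, rfl⟩)
    have h3 : f k - T (fun j => b (σ.symm j))
        = v + ∑ i ∈ Finset.range n with σ i ∉ K, b i • f (σ i) := by
      rw [sub_eq_iff_eq_add, add_assoc, add_comm _ (T _), hsum]; abel
    rw [h3]
    exact add_mem hv h2
  choose b hb hbV using key
  have hTk : T (Pi.single ⟨k, hk⟩ 1) = f k := by
    rw [hT, Finset.sum_eq_single ⟨k, hk⟩ (fun j _ hj => by simp [Pi.single_eq_of_ne hj])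
      (by simp)]
    simp
  have hlim : Tendsto (fun m => Pi.single (⟨k, hk⟩ : K) (1 : 𝕜) - b m) atTop
      (𝓝 (Pi.single ⟨k, hk⟩ 1)) := by
    have hb0 : Tendsto b atTop (𝓝 0) := by
      rw [tendsto_pi_nhds]
      intro j
      refine squeeze_zero_norm (fun m => hb m j) ?_
      simpa using tendsto_one_div_add_atTop_nhds_zero_nat.const_mul (C j)
    simpa using hb0.const_sub (Pi.single (⟨k, hk⟩ : K) (1 : 𝕜))
  have hmem := hcl.mem_of_tendsto hlim (.of_forall fun m => by
    simp only [SetLike.mem_coe, Submodule.mem_comap, map_sub, hTk]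
    exact hbV m)
  simpa only [SetLike.mem_coe, Submodule.mem_comap, hTk] using hmem

theorem SubframeDecomposition.K_eq_empty [CompleteSpace H] (D : SubframeDecomposition 𝕜 f)
    {σ : Equiv.Perm ℕ} (h : ProjectionMethod 𝕜 (f ∘ σ)) : D.K = ∅ := by
  refine Finset.eq_empty_of_forall_notMem fun k hk => ?_
  have hIK : D.I ⊆ (D.K : Set ℕ)ᶜ := Set.subset_compl_iff_disjoint_right.2 D.disjoint_I_K
  have hle : Submodule.span 𝕜 (f '' (D.K : Set ℕ)ᶜ) ≤ Submodule.span 𝕜 (f '' D.I) := by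
    refine Submodule.span_le.2 ?_
    rintro _ ⟨i, hi, rfl⟩
    exact D.mem_span_of_notMem hi
  have htop : (Submodule.span 𝕜 (f '' (D.K : Set ℕ)ᶜ)).topologicalClosure = ⊤ := by
    rw [eq_top_iff, ← D.rieszBasis.1, closedSpan_subtype]
    exact Submodule.topologicalClosure_mono (Submodule.span_mono (Set.image_mono hIK))
  have := hle (h.mem_span_compl D.K htop hk)
  rw [Set.image_eq_range] at this
  exact (D.infinite_support k hk).notMem_span D.rieszBasis this

end

end FrameTheory

/-! ### Uniform lower bounds by Baire's theorem, and extension of lower Riesz bounds -/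

namespace FrameTheory

section

variable {𝕜 H ι : Type*} [RCLike 𝕜] [NormedAddCommGroup H] [InnerProductSpace 𝕜 H]
  {f : ι → H} {A B : ℝ} {s t : Set ι}

theorem energy_eq_tsum_indicator (f : ι → H) (s : Set ι) (x : H) :
    energy 𝕜 f s x = ∑' i, s.indicator (fun i => ‖(inner 𝕜 (f i) x : 𝕜)‖ ^ 2) i :=
  tsum_subtype s fun i => ‖(inner 𝕜 (f i) x : 𝕜)‖ ^ 2

theorem energy_eq_of_subset (hst : s ⊆ t) {x : H}
    (h : ∀ i ∈ t, i ∉ s → (inner 𝕜 (f i) x : 𝕜) = 0) : energy 𝕜 f t x = energy 𝕜 f s x := by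
  simp only [energy_eq_tsum_indicator]
  refine tsum_congr fun i => ?_
  by_cases hs : i ∈ s
  · rw [Set.indicator_of_mem hs, Set.indicator_of_mem (hst hs)]
  · by_cases ht : i ∈ t
    · rw [Set.indicator_of_notMem hs, Set.indicator_of_mem ht, h i ht hs]; simp
    · rw [Set.indicator_of_notMem hs, Set.indicator_of_notMem ht]

/-- The subfamilies with a given lower frame bound form a closed subset of the Cantor space. -/
theorem IsBessel.isClosed_lowerBound (hf : IsBessel 𝕜 f B) (A : ℝ) :
    IsClosed {χ : ι → Bool | LowerBound 𝕜 f {i | χ i = true} A} := by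
  have hset : {χ : ι → Bool | LowerBound 𝕜 f {i | χ i = true} A}
      = ⋂ (F : Finset ι) (x : H) (_ : x ∈ Submodule.span 𝕜 (f '' (F : Set ι))),
        {χ : ι → Bool | (∀ i ∈ F, χ i = true) → A * ‖x‖ ^ 2 ≤ energy 𝕜 f {i | χ i = true} x} := by
    ext χ
    simp only [Set.mem_iInter, Set.mem_ofPred_eq]
    constructor
    · intro h F x hx hF
      exact h x (Submodule.span_mono (Set.image_mono fun i hi => hF i hi) hx)
    · intro h x hx
      obtain ⟨F, hF, hxF⟩ := exists_finset_mem_span hx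
      exact h F x hxF fun i hi => hF hi
  rw [hset]
  refine isClosed_iInter fun F => isClosed_iInter fun x => isClosed_iInter fun _ =>
    isClosed_imp ?_ ?_
  · have : {χ : ι → Bool | ∀ i ∈ F, χ i = true} = ⋂ i ∈ F, (fun χ => χ i) ⁻¹' {true} := by
      ext; simp
    rw [this]
    exact isOpen_biInter_finset fun i _ => (isOpen_discrete _).preimage (continuous_apply i)
  · refine isClosed_le continuous_const ?_
    have he : (fun χ : ι → Bool => energy 𝕜 f {i | χ i = true} x) = fun χ =>
        ∑' i, (fun b : Bool => if b = true then ‖(inner 𝕜 (f i) x : 𝕜)‖ ^ 2 else 0) (χ i) := by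
      funext χ
      rw [energy_eq_tsum_indicator]
      simp [Set.indicator_apply]
    rw [he]
    refine continuous_tsum (fun i => (continuous_of_discreteTopology (f := fun b : Bool =>
        if b = true then ‖(inner 𝕜 (f i) x : 𝕜)‖ ^ 2 else 0)).comp (continuous_apply i))
      (hf.summable x) fun i χ => ?_
    dsimp only
    split_ifs
    · simp
    · simp

/-- By Baire's theorem in the Cantor space of all subfamilies, a Bessel sequence with the subframe
property has a common lower frame bound for all subfamilies with a suitable initial pattern. -/
theorem HasSubframeProperty.exists_uniform_lowerBound {f : ℕ → H} (hsub : HasSubframeProperty 𝕜 f)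
    (hf : IsBessel 𝕜 f B) :
    ∃ (N : ℕ) (D : Finset ℕ) (A : ℝ), 0 < A ∧ (∀ i ∈ D, i < N) ∧
      ∀ E ⊆ Set.Ici N, LowerBound 𝕜 f (D ∪ E) A := by
  classical
  obtain ⟨m, χ₀, hχ₀⟩ := nonempty_interior_of_iUnion_of_closed
    (f := fun m : ℕ => {χ : ℕ → Bool | LowerBound 𝕜 f {i | χ i = true} (1 / ((m : ℝ) + 1))})
    (fun m => hf.isClosed_lowerBound _) (by
      refine Set.eq_univ_of_forall fun χ => Set.mem_iUnion.2 ?_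
      obtain ⟨A, B', hA, -, h⟩ := hsub {i | χ i = true}
      obtain ⟨m, hm⟩ := exists_nat_one_div_lt hA
      exact ⟨m, h.lowerBound.mono hm.le⟩)
  obtain ⟨I, u, hu, hsubset⟩ := isOpen_pi_iff.1 isOpen_interior χ₀ hχ₀
  obtain ⟨N, hN⟩ : ∃ N, ∀ i ∈ I, i < N :=
    ⟨I.sup id + 1, fun i hi => Nat.lt_succ_of_le (Finset.le_sup (f := id) hi)⟩
  refine ⟨N, {i ∈ Finset.range N | χ₀ i = true}, 1 / ((m : ℝ) + 1), by positivity,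
    fun i hi => by simpa using (Finset.mem_filter.1 hi).1, fun E hE => ?_⟩
  set χ : ℕ → Bool := fun i => if i < N then χ₀ i else decide (i ∈ E) with hχ
  have hmem : χ ∈ (I : Set ℕ).pi u := fun i hi => by
    simp only [hχ, if_pos (hN i hi)]
    exact (hu i hi).2
  have h := interior_subset (hsubset hmem)
  have hs : {i | χ i = true} = (({i ∈ Finset.range N | χ₀ i = true} : Finset ℕ) : Set ℕ) ∪ E := by
    ext i
    by_cases hi : i < N
    · have : i ∉ E := fun h => absurd (hE h) (by simpa using hi)
      simp [hχ, hi, this]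
    · simp [hχ, hi]
  simp only [Set.mem_ofPred_eq] at h
  rwa [hs] at h

/-- For a linearly independent finite family, the lower frame bound is a lower Riesz bound. -/
theorem LowerBound.le_norm_sum_sq {F : Finset ι} (h : LowerBound 𝕜 f F A) (hA : 0 < A)
    (hli : LinearIndepOn 𝕜 f (F : Set ι)) (a : ι → 𝕜) :
    A * ∑ i ∈ F, ‖a i‖ ^ 2 ≤ ‖∑ i ∈ F, a i • f i‖ ^ 2 := by
  set V := Submodule.span 𝕜 (f '' (F : Set ι))
  have : FiniteDimensional 𝕜 V := FiniteDimensional.span_of_finite 𝕜 (F.finite_toSet.image f)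
  let Φ : V →ₗ[𝕜] (F → 𝕜) :=
    LinearMap.pi fun i : F => (innerSL 𝕜 (f i)).toLinearMap.comp V.subtype
  have hΦ : ∀ z i, Φ z i = inner 𝕜 (f i) (z : H) := fun z i => rfl
  have hinj : Function.Injective Φ := by
    rw [injective_iff_map_eq_zero]
    intro z hz
    have h1 := h z z.2
    rw [energy_coe, Finset.sum_eq_zero fun i hi => by
      rw [← hΦ z ⟨i, hi⟩, hz, Pi.zero_apply, norm_zero, sq, zero_mul]] at h1
    have h2 : ‖(z : H)‖ ^ 2 = 0 := by nlinarith [sq_nonneg ‖(z : H)‖]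
    exact Subtype.ext (norm_eq_zero.1 (pow_eq_zero_iff two_ne_zero |>.1 h2))
  have hrank : Module.finrank 𝕜 V = Module.finrank 𝕜 (F → 𝕜) := by
    have h1 := finrank_span_eq_card hli
    rw [← Set.image_eq_range] at h1
    exact h1.trans ((Fintype.card_coe F).trans (by simp))
  obtain ⟨z, hz⟩ := (LinearMap.injective_iff_surjective_of_finrank_eq_finrank hrank).1 hinj
    fun i => a i
  have hza : ∀ i ∈ F, (inner 𝕜 (f i) (z : H) : 𝕜) = a i := fun i hi => by
    rw [← hΦ z ⟨i, hi⟩, hz]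
  set S := ∑ i ∈ F, ‖a i‖ ^ 2 with hS
  set v := ∑ i ∈ F, a i • f i with hv
  have hS0 : 0 ≤ S := Finset.sum_nonneg fun _ _ => by positivity
  have h1 : A * ‖(z : H)‖ ^ 2 ≤ S := by
    have := h z z.2
    rwa [energy_coe, Finset.sum_congr rfl fun i hi => by rw [hza i hi]] at this
  have h2 : S ≤ ‖v‖ * ‖(z : H)‖ := by
    have e : inner 𝕜 v (z : H) = (S : 𝕜) := by
      rw [hv, hS, sum_inner]
      push_cast
      refine Finset.sum_congr rfl fun i hi => ?_
      rw [inner_smul_left, hza i hi, RCLike.conj_mul]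
    have := norm_inner_le_norm (𝕜 := 𝕜) v (z : H)
    rwa [e, RCLike.norm_ofReal, abs_of_nonneg hS0] at this
  rcases hS0.eq_or_lt with h0 | h0
  · rw [← h0, mul_zero]; positivity
  refine le_of_mul_le_mul_right ?_ h0
  calc A * S * S = A * S ^ 2 := by ring
    _ ≤ A * (‖v‖ * ‖(z : H)‖) ^ 2 := by gcongr
    _ = ‖v‖ ^ 2 * (A * ‖(z : H)‖ ^ 2) := by ring
    _ ≤ _ := by gcongr

theorem RieszLowerBound.of_lowerBound (h : ∀ F : Finset ι, ↑F ⊆ s → LowerBound 𝕜 f F A)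
    (hA : 0 < A) (hli : LinearIndepOn 𝕜 f s) : RieszLowerBound 𝕜 f s A :=
  fun F a hF => (h F hF).le_norm_sum_sq hA (hli.mono hF) a

/-- Two families can be joined to one with a lower Riesz bound if the first has a lower Riesz bound
and the coefficients at the second are controlled. -/
theorem RieszLowerBound.union {c C : ℝ} (h : RieszLowerBound 𝕜 f s c) (hc : 0 < c)
    (hf : IsBessel 𝕜 f B) (hC : 0 ≤ C) [DecidablePred (· ∈ s)]
    (ht : ∀ (F : Finset ι) (a : ι → 𝕜), ↑F ⊆ s ∪ t →
      ∑ i ∈ F with i ∉ s, ‖a i‖ ^ 2 ≤ C * ‖∑ i ∈ F, a i • f i‖ ^ 2) :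
    ∃ c', 0 < c' ∧ RieszLowerBound 𝕜 f (s ∪ t) c' := by
  have hB := hf.nonneg
  set P := c⁻¹ * (2 + 2 * (B * C)) + C with hP
  have hPpos : 0 < P := by positivity
  refine ⟨P⁻¹, by positivity, fun F a hF => ?_⟩
  have h2 := ht F a hF
  rw [inv_mul_eq_div, div_le_iff₀ hPpos, ← Finset.sum_filter_add_sum_filter_not F (· ∈ s)]
  set x := ∑ i ∈ F, a i • f i with hx
  set x₁ := ∑ i ∈ F with i ∈ s, a i • f i with hx₁
  set x₂ := ∑ i ∈ F with i ∉ s, a i • f i with hx₂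
  have hsplit : x₁ = x - x₂ := by
    rw [hx, hx₂, hx₁, ← Finset.sum_filter_add_sum_filter_not F (· ∈ s)]; abel
  have h1 : c * ∑ i ∈ F with i ∈ s, ‖a i‖ ^ 2 ≤ ‖x₁‖ ^ 2 :=
    h _ a fun i hi => (Finset.mem_filter.1 hi).2
  have h3 : ‖x₂‖ ^ 2 ≤ B * (C * ‖x‖ ^ 2) :=
    (hf.norm_sum_sq_le _ a).trans (mul_le_mul_of_nonneg_left h2 hB)
  have h4 : ‖x₁‖ ^ 2 ≤ 2 * (‖x‖ ^ 2 + ‖x₂‖ ^ 2) := by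
    rw [hsplit]
    exact (pow_le_pow_left₀ (norm_nonneg _) (norm_sub_le _ _) 2).trans add_sq_le
  have h5 : ∑ i ∈ F with i ∈ s, ‖a i‖ ^ 2 ≤ c⁻¹ * (2 * (‖x‖ ^ 2 + B * (C * ‖x‖ ^ 2))) := by
    rw [inv_mul_eq_div, le_div_iff₀ hc]
    linarith
  calc _ ≤ c⁻¹ * (2 * (‖x‖ ^ 2 + B * (C * ‖x‖ ^ 2))) + C * ‖x‖ ^ 2 := add_le_add h5 h2
    _ = _ := by rw [hP]; ring

/-- A lower Riesz bound survives the adjunction of a vector outside the closed span. -/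
theorem RieszLowerBound.exists_insert {c : ℝ} (h : RieszLowerBound 𝕜 f s c) (hc : 0 < c)
    (hf : IsBessel 𝕜 f B) {i : ι}
    (hi : f i ∉ (Submodule.span 𝕜 (f '' s)).topologicalClosure) :
    ∃ c', 0 < c' ∧ RieszLowerBound 𝕜 f (s ∪ {i}) c' := by
  classical
  have his : i ∉ s := fun his =>
    hi (Submodule.le_topologicalClosure _ (Submodule.subset_span ⟨i, his, rfl⟩))
  set V := Submodule.span 𝕜 (f '' s) with hV
  rw [← SetLike.mem_coe, Submodule.topologicalClosure_coe, Metric.mem_closure_iff] at hi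
  push Not at hi
  obtain ⟨δ, hδ, hdist⟩ := hi
  have hdist' : ∀ (b : 𝕜), ∀ v ∈ V, ‖b‖ * δ ≤ ‖b • f i + v‖ := by
    intro b v hv
    rcases eq_or_ne b 0 with rfl | hb
    · simp
    have h1 := hdist (-(b⁻¹ • v)) (neg_mem (V.smul_mem _ hv))
    rw [dist_eq_norm, sub_neg_eq_add] at h1
    calc ‖b‖ * δ ≤ ‖b‖ * ‖f i + b⁻¹ • v‖ := by gcongr
      _ = ‖b • f i + v‖ := by rw [← norm_smul, smul_add, smul_inv_smul₀ hb]
  refine h.union hc hf (C := (δ ^ 2)⁻¹) (by positivity) fun F a hF => ?_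
  rw [inv_mul_eq_div, le_div_iff₀ (by positivity)]
  by_cases hiF : i ∈ F
  · have hfil : {j ∈ F | j ∉ s} = {i} := by
      ext j
      simp only [Finset.mem_filter, Finset.mem_singleton]
      constructor
      · rintro ⟨hj, hjs⟩
        exact (hF hj).resolve_left hjs
      · rintro rfl
        exact ⟨hiF, his⟩
    rw [hfil, Finset.sum_singleton, ← mul_pow, ← Finset.add_sum_erase F _ hiF]
    refine pow_le_pow_left₀ (by positivity) (hdist' _ _ (sum_mem fun j hj => ?_)) 2
    have hj' := Finset.mem_erase.1 hj
    exact V.smul_mem _ (Submodule.subset_span ⟨j, (hF hj'.2).resolve_right hj'.1, rfl⟩)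
  · rw [Finset.filter_false_of_mem fun j hj => ?_, Finset.sum_empty, zero_mul]
    · positivity
    · rintro hjs
      have : j = i := (hF hj).resolve_left hjs
      exact hiF (this ▸ hj)

/-- Finitely many further vectors can be brought into the closed span of a subfamily with a lower
Riesz bound by adjoining some of them. -/
theorem RieszLowerBound.exists_union_finset {c : ℝ} (h : RieszLowerBound 𝕜 f s c) (hc : 0 < c)
    (hf : IsBessel 𝕜 f B) (F : Finset ι) :
    ∃ D : Finset ι, D ⊆ F ∧ (∃ c', 0 < c' ∧ RieszLowerBound 𝕜 f (s ∪ D) c') ∧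
      ∀ i ∈ F, f i ∈ (Submodule.span 𝕜 (f '' (s ∪ D))).topologicalClosure := by
  classical
  induction F using Finset.induction_on with
  | empty => exact ⟨∅, subset_rfl, ⟨c, hc, by simpa using h⟩, by simp⟩
  | insert i F _ ih =>
    obtain ⟨D, hDF, ⟨c', hc', h'⟩, hD⟩ := ih
    by_cases hi : f i ∈ (Submodule.span 𝕜 (f '' (s ∪ D))).topologicalClosure
    · refine ⟨D, hDF.trans (Finset.subset_insert _ _), ⟨c', hc', h'⟩, fun j hj => ?_⟩
      rcases Finset.mem_insert.1 hj with rfl | hj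
      exacts [hi, hD j hj]
    · obtain ⟨c'', hc'', h''⟩ := h'.exists_insert hc' hf hi
      have he : s ∪ ((insert i D : Finset ι) : Set ι) = s ∪ D ∪ {i} := by
        rw [Finset.coe_insert, Set.union_assoc, Set.union_singleton]
      refine ⟨insert i D, Finset.insert_subset_insert _ hDF, ⟨c'', hc'', he ▸ h''⟩, fun j hj => ?_⟩
      rw [he]
      rcases Finset.mem_insert.1 hj with rfl | hj
      · exact Submodule.le_topologicalClosure _ (Submodule.subset_span ⟨j, by simp, rfl⟩)
      · exact Submodule.topologicalClosure_mono
          (Submodule.span_mono (Set.image_mono Set.subset_union_left)) (hD j hj)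

end

end FrameTheory

/-! ### Extraction of a Riesz basis -/

namespace FrameTheory

section

variable {𝕜 H ι : Type*} [RCLike 𝕜] [NormedAddCommGroup H] [InnerProductSpace 𝕜 H]
  {f : ι → H} {A B : ℝ} {s t : Set ι}

theorem IsFrame.closedSpan_eq_top [CompleteSpace H] {f : ℕ → H} (hf : IsFrame 𝕜 f) :
    closedSpan 𝕜 f = ⊤ := by
  refine eq_top_iff.2 fun x _ => ?_
  obtain ⟨y, hy, -⟩ := hf.exists_inner_dualFrame_eq x
  rw [closedSpan, ← SetLike.mem_coe, Submodule.topologicalClosure_coe]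
  refine mem_closure_of_tendsto hy (.of_forall fun F => ?_)
  exact sum_mem fun i _ => Submodule.smul_mem _ _ (Submodule.subset_span ⟨i, rfl⟩)

/-- A frame with the subframe property contains a Riesz basis `(f i)_{i ∈ I}`, and up to finitely
many members it is a Riesz frame relative to a finite subfamily `D`: with finitely many exceptions,
its members are finite combinations of the Riesz basis, and adding to `D` any set of indices
`≥ N` gives a subfamily with the lower frame bound `A`. -/
theorem HasSubframeProperty.exists_rieszSubfamily [CompleteSpace H] {f : ℕ → H}
    (hsub : HasSubframeProperty 𝕜 f) (hf : IsFrame 𝕜 f) :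
    ∃ (N : ℕ) (D : Finset ℕ) (A : ℝ) (I : Set ℕ) (c : ℝ), 0 < A ∧ 0 < c ∧ (∀ i ∈ D, i < N) ∧
      (∀ E ⊆ Set.Ici N, LowerBound 𝕜 f (D ∪ E) A) ∧ RieszLowerBound 𝕜 f I c ∧
      (Submodule.span 𝕜 (f '' I)).topologicalClosure = ⊤ ∧
      (∀ i ∈ D, f i ∈ Submodule.span 𝕜 (f '' (I ∩ D))) ∧
      ∀ i ≥ N, f i ∈ Submodule.span 𝕜 (f '' (I ∩ D ∪ I ∩ Set.Ici N)) := by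
  classical
  obtain ⟨B, hB⟩ := hf.exists_isBessel
  obtain ⟨N, D, A, hA, hDN, hlow⟩ := hsub.exists_uniform_lowerBound hB
  obtain ⟨D₁, hD₁D, ⟨c₁, hc₁, hr₁⟩, hD₁⟩ :=
    RieszLowerBound.exists_union_finset (𝕜 := 𝕜) (f := f) (s := ∅) (c := 1)
      (fun F a hF => by simp [Finset.coe_eq_empty.1 (Set.subset_empty_iff.1 hF)]) one_pos hB D
  rw [Set.empty_union] at hr₁ hD₁
  have : FiniteDimensional 𝕜 (Submodule.span 𝕜 (f '' (D₁ : Set ℕ))) :=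
    FiniteDimensional.span_of_finite 𝕜 (D₁.finite_toSet.image f)
  rw [(Submodule.closed_of_finiteDimensional _).submodule_topologicalClosure_eq] at hD₁
  set L := Submodule.span 𝕜 (f '' (D : Set ℕ)) with hL
  have : FiniteDimensional 𝕜 L := FiniteDimensional.span_of_finite 𝕜 (D.finite_toSet.image f)
  have hLD₁ : L ≤ Submodule.span 𝕜 (f '' (D₁ : Set ℕ)) := by
    refine Submodule.span_le.2 ?_
    rintro _ ⟨i, hi, rfl⟩
    exact hD₁ i hi
  -- the family `u` is the part of `f` orthogonal to the span of `(f i)_{i ∈ D}`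
  set Q := Lᗮ.starProjection with hQ
  have hQL : ∀ x ∈ L, Q x = 0 := fun x hx => by
    rw [hQ, Submodule.starProjection_orthogonal', sub_apply,
      Submodule.starProjection_eq_self_iff.2 hx]
    exact sub_self x
  have hxQ : ∀ x, x - Q x ∈ L := fun x => by
    rw [hQ, Submodule.starProjection_orthogonal', sub_apply]
    simp
  set u : ℕ → H := fun i => Q (f i) with hu
  have huspan : ∀ (E' : Set ℕ), Submodule.span 𝕜 (u '' E') ≤ Submodule.span 𝕜 (f '' (D ∪ E')) := by
    intro E'
    refine Submodule.span_le.2 ?_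
    rintro _ ⟨i, hi, rfl⟩
    have h1 := sub_mem (Submodule.subset_span ⟨i, Or.inr hi, rfl⟩ :
        f i ∈ Submodule.span 𝕜 (f '' (D ∪ E')))
      (Submodule.span_mono (Set.image_mono Set.subset_union_left) (hxQ (f i)))
    simpa [hu] using h1
  have hulow : ∀ E' ⊆ Set.Ici N, LowerBound 𝕜 u E' A := by
    intro E' hE' x hx
    have hxL : x ∈ Lᗮ := by
      refine (Submodule.span_le.2 ?_ : Submodule.span 𝕜 (u '' E') ≤ Lᗮ) hx
      rintro _ ⟨i, -, rfl⟩
      exact Submodule.starProjection_apply_mem _ _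
    have h1 := hlow E' hE' x (huspan E' hx)
    rw [energy_eq_of_subset (Set.subset_union_right : E' ⊆ (D : Set ℕ) ∪ E')
      fun i hi hiE => (Submodule.mem_orthogonal L x).1 hxL _
        (Submodule.subset_span ⟨i, hi.resolve_right hiE, rfl⟩)] at h1
    refine h1.trans_eq (energy_congr fun i _ => ?_)
    rw [hu, hQ, Submodule.inner_starProjection_left_eq_right,
      Submodule.starProjection_eq_self_iff.2 hxL]
  obtain ⟨E, hEN, -, hEspan, hEli⟩ := exists_linearIndepOn_extension
    (linearIndepOn_empty 𝕜 u) (Set.empty_subset (Set.Ici N))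
  have hru : RieszLowerBound 𝕜 u E A :=
    .of_lowerBound (fun F hF => hulow F (hF.trans hEN)) hA hEli
  obtain ⟨c₂, hc₂, hr₂⟩ := hr₁.union hc₁ hB (t := E) (C := A⁻¹) (by positivity) fun F a hF => by
    rw [inv_mul_eq_div, le_div_iff₀ hA, mul_comm]
    refine (hru _ a fun i hi => ?_).trans (pow_le_pow_left₀ (norm_nonneg _) ?_ 2)
    · have := Finset.mem_filter.1 hi
      exact (hF this.1).resolve_left this.2
    · refine le_trans (le_of_eq ?_) (Lᗮ.norm_starProjection_apply_le (∑ i ∈ F, a i • f i))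
      have hz : ∑ i ∈ F with i ∈ (D₁ : Set ℕ), Q (a i • f i) = 0 :=
        Finset.sum_eq_zero fun i hi => by
          rw [map_smul, hQL _ (Submodule.subset_span ⟨i, hD₁D (Finset.mem_filter.1 hi).2, rfl⟩),
            smul_zero]
      rw [map_sum, ← hQ, ← Finset.sum_filter_add_sum_filter_not F (· ∈ (D₁ : Set ℕ)), hz, zero_add]
      simp only [map_smul, hu]
  obtain ⟨D₂, hD₂, ⟨c, hc, hr⟩, hD₂mem⟩ := hr₂.exists_union_finset hc₂ hB (Finset.range N)
  set I : Set ℕ := (D₁ : Set ℕ) ∪ E ∪ D₂ with hI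
  have hD₁I : (D₁ : Set ℕ) ⊆ I ∩ D := fun i hi => ⟨Or.inl (Or.inl hi), hD₁D hi⟩
  have hEI : E ⊆ I ∩ Set.Ici N := fun i hi => ⟨Or.inl (Or.inr hi), hEN hi⟩
  have hLI : L ≤ Submodule.span 𝕜 (f '' (I ∩ D)) :=
    hLD₁.trans (Submodule.span_mono (Set.image_mono hD₁I))
  have hLI' : L ≤ Submodule.span 𝕜 (f '' (I ∩ D ∪ I ∩ Set.Ici N)) :=
    hLI.trans (Submodule.span_mono (Set.image_mono Set.subset_union_left))
  have htail : ∀ i ≥ N, f i ∈ Submodule.span 𝕜 (f '' (I ∩ D ∪ I ∩ Set.Ici N)) := by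
    intro i hi
    have h1 : Submodule.span 𝕜 (u '' E) ≤ Submodule.span 𝕜 (f '' (I ∩ D ∪ I ∩ Set.Ici N)) := by
      refine (huspan E).trans ?_
      rw [Set.image_union, Submodule.span_union]
      exact sup_le hLI' (Submodule.span_mono (Set.image_mono (hEI.trans Set.subset_union_right)))
    have h2 := add_mem (h1 (hEspan ⟨i, hi, rfl⟩)) (hLI' (hxQ (f i)))
    simpa [hu] using h2
  refine ⟨N, D, A, I, c, hA, hc, hDN, hlow, hr, ?_,
    fun i hi => hLI (Submodule.subset_span ⟨i, hi, rfl⟩), htail⟩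
  rw [eq_top_iff, ← hf.closedSpan_eq_top, closedSpan]
  refine Submodule.topologicalClosure_minimal _ (Submodule.span_le.2 ?_)
    (Submodule.isClosed_topologicalClosure _)
  rintro _ ⟨i, rfl⟩
  rcases lt_or_ge i N with hi | hi
  · exact hD₂mem i (Finset.mem_range.2 hi)
  · refine Submodule.le_topologicalClosure _ (Submodule.span_mono (Set.image_mono ?_) (htail i hi))
    exact Set.union_subset Set.inter_subset_left Set.inter_subset_left

/-- Expansion of every vector, and the biorthogonal family, of a frame with a lower Riesz bound. -/
theorem RieszLowerBound.exists_hasSum_and_biorthogonal [CompleteSpace H] [DecidableEq ι] {c : ℝ}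
    (h : RieszLowerBound 𝕜 f Set.univ c) (hc : 0 < c) (hf : IsBessel 𝕜 f B) (hA : 0 < A)
    (hlow : ∀ x, A * ‖x‖ ^ 2 ≤ ∑' i, ‖(inner 𝕜 (f i) x : 𝕜)‖ ^ 2) :
    (∀ x, ∃ a : ι → 𝕜, HasSum (fun i => a i • f i) x) ∧
      ∃ d : ι → H, ∀ j k, (inner 𝕜 (d j) (f k) : 𝕜) = if j = k then 1 else 0 := by
  have hexp : ∀ x, ∃ y, HasSum (fun i => (inner 𝕜 (f i) y : 𝕜) • f i) x := fun x => by
    obtain ⟨y, rfl⟩ := (hf.frameOp_bijective hA hlow).2 x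
    exact ⟨y, hf.hasSum_frameOp y⟩
  refine ⟨fun x => (hexp x).elim fun y hy => ⟨_, hy⟩, ?_⟩
  choose d hd using fun j => hexp (f j)
  refine ⟨d, fun j k => ?_⟩
  have h1 : HasSum (fun i => (if i = j then (1 : 𝕜) else 0) • f i) (f j) := by
    convert! hasSum_ite_eq j (f j) using 2 with i
    split_ifs with hi
    · rw [one_smul, hi]
    · rw [zero_smul]
  have h2 := congrFun (h.eq_of_hasSum hc (hd j) h1) k
  rw [← inner_conj_symm, h2]
  simp [eq_comm, apply_ite]

end

end FrameTheory

/-! ### Existence of a decomposition -/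

namespace FrameTheory

section

variable {𝕜 H : Type*} [RCLike 𝕜] [NormedAddCommGroup H] [InnerProductSpace 𝕜 H]
  {f : ℕ → H} {A B c : ℝ} {I : Set ℕ}

theorem RieszLowerBound.lowerBound (hr : RieszLowerBound 𝕜 f I c) (hc : 0 < c)
    (hB : IsBessel 𝕜 f B) {s : Set ℕ} (hs : s ⊆ I) : LowerBound 𝕜 f s c := by
  refine .of_norm_inner_sq_le fun y hy z => ?_
  obtain ⟨F, hF, a, rfl⟩ := mem_span_image_iff_exists_finset.1 hy
  have h1 := hr F a (hF.trans hs)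
  have h2 := norm_inner_sum_sq_le F a f z
  rw [← energy_coe] at h2
  calc c * ‖(inner 𝕜 (∑ i ∈ F, a i • f i) z : 𝕜)‖ ^ 2
      ≤ c * ((∑ i ∈ F, ‖a i‖ ^ 2) * energy 𝕜 f F z) := by gcongr
    _ = (c * ∑ i ∈ F, ‖a i‖ ^ 2) * energy 𝕜 f F z := by ring
    _ ≤ _ := mul_le_mul h1 (hB.energy_mono hF z) (energy_nonneg _) (by positivity)

theorem isRieszFrame_of_lowerBound {ι : Type*} {v : ι → H} (hv : IsBessel 𝕜 v B)
    (hA : 0 < A) (h : ∀ s, LowerBound 𝕜 v s A) (htop : closedSpan 𝕜 v = ⊤) : IsRieszFrame 𝕜 v := by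
  have hB : 0 < B + 1 := by linarith [hv.nonneg]
  have hv' : IsBessel 𝕜 v (B + 1) :=
    ⟨hB.le, hv.summable, fun x => (hv.le x).trans (by gcongr; linarith)⟩
  refine ⟨⟨A, B + 1, hA, hB, fun x _ => ⟨hv.summable x, ?_, hv'.le x⟩⟩,
    A, B + 1, hA, hB, fun s => (h s).frameBoundsOn hv'⟩
  rw [← energy_univ]
  refine (h Set.univ).le_of_mem_closure hv ?_
  rw [Set.image_univ]
  exact (htop ▸ Submodule.mem_top : x ∈ closedSpan 𝕜 v)

variable [CompleteSpace H]

/-- Vectors that are not finite combinations of a Riesz basis have infinite support. -/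
theorem RieszLowerBound.hasInfiniteSupport (hr : RieszLowerBound 𝕜 f I c) (hc : 0 < c)
    (hB : IsBessel 𝕜 f B) (htop : (Submodule.span 𝕜 (f '' I)).topologicalClosure = ⊤)
    (hlow : LowerBound 𝕜 f I A) (hA : 0 < A) {x : H} (hx : x ∉ Submodule.span 𝕜 (f '' I)) :
    HasInfiniteSupport 𝕜 (fun i : I => f i) x := by
  classical
  obtain ⟨c', hc', hr'⟩ := (hr.isRieszBasis hc hB htop).exists_rieszLowerBound
  obtain ⟨a, ha⟩ := (hr'.exists_hasSum_and_biorthogonal hc' (hB.subtype I) hA fun y =>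
    hlow.le_of_mem_closure hB (htop ▸ Submodule.mem_top)).1 x
  refine ⟨a, ha, fun hfin => hx ?_⟩
  have h1 := hasSum_sum_of_ne_finset_zero (f := fun i : I => a i • f i) (s := hfin.toFinset)
    (L := .unconditional I) fun i hi => by
      have : a i = 0 := by simpa using hi
      rw [this, zero_smul]
  rw [ha.unique h1]
  exact sum_mem fun i _ => Submodule.smul_mem _ _ (Submodule.subset_span ⟨i, i.2, rfl⟩)

/-- The bounded oblique projection onto the span of finitely many members of a Riesz basis along
the closed span of the others. -/
theorem RieszLowerBound.exists_obliqueProjection (hr : RieszLowerBound 𝕜 f I c) (hc : 0 < c)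
    (hB : IsBessel 𝕜 f B) (htop : (Submodule.span 𝕜 (f '' I)).topologicalClosure = ⊤)
    (hlow : LowerBound 𝕜 f I A) (hA : 0 < A) {M : Finset ℕ} (hM : (M : Set ℕ) ⊆ I) :
    ∃ R : H →L[𝕜] H, (∀ x, R x ∈ Submodule.span 𝕜 (f '' M)) ∧ (∀ j ∈ M, R (f j) = f j) ∧
      (∀ j ∈ I, j ∉ M → R (f j) = 0) ∧ Summable fun i => ‖R (f i)‖ ^ 2 := by
  classical
  obtain ⟨c', hc', hr'⟩ := (hr.isRieszBasis hc hB htop).exists_rieszLowerBound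
  obtain ⟨d, hd⟩ := (hr'.exists_hasSum_and_biorthogonal hc' (hB.subtype I) hA fun y =>
    hlow.le_of_mem_closure hB (htop ▸ Submodule.mem_top)).2
  set e : M → H := fun j => d ⟨j, hM j.2⟩ with he
  have hR : ∀ x, (∑ j : M, (innerSL 𝕜 (e j)).smulRight (f j) : H →L[𝕜] H) x
      = ∑ j : M, (inner 𝕜 (e j) x : 𝕜) • f j := fun x => by simp
  have hRI : ∀ k ∈ I, (∑ j : M, (innerSL 𝕜 (e j)).smulRight (f j) : H →L[𝕜] H) (f k)
      = ∑ j : M, if (j : ℕ) = k then f j else 0 := fun k hk => by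
    rw [hR]
    refine Finset.sum_congr rfl fun j _ => ?_
    rw [he, hd ⟨j, hM j.2⟩ ⟨k, hk⟩]
    simp
  refine ⟨∑ j : M, (innerSL 𝕜 (e j)).smulRight (f j), fun x => ?_, fun k hk => ?_,
    fun k hk hkM => ?_, ?_⟩
  · rw [hR]
    exact sum_mem fun j _ => Submodule.smul_mem _ _ (Submodule.subset_span ⟨j, j.2, rfl⟩)
  · rw [hRI k (hM hk), Finset.sum_eq_single ⟨k, hk⟩ (fun j _ hj => if_neg fun h =>
      hj (Subtype.ext h)) (by simp), if_pos rfl]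
  · rw [hRI k hk]
    exact Finset.sum_eq_zero fun j _ => if_neg fun (h : (j : ℕ) = k) => hkM (h ▸ j.2)
  · have hs : Summable fun i => (Fintype.card M : ℝ)
        * ∑ j : M, ‖(inner 𝕜 (f i) (e j) : 𝕜)‖ ^ 2 * ‖f j‖ ^ 2 :=
      (summable_sum fun j _ => (hB.summable (e j)).mul_right _).mul_left _
    refine hs.of_nonneg_of_le (fun i => by positivity) fun i => ?_
    rw [hR]
    refine (pow_le_pow_left₀ (norm_nonneg _) (norm_sum_le _ _) 2).trans ?_
    refine sq_sum_le_card_mul_sum_sq.trans_eq ?_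
    simp only [norm_smul, mul_pow, Finset.card_univ]
    congr 1
    exact Finset.sum_congr rfl fun j _ => by rw [norm_inner_symm]

/-- A member `f i` of the Riesz basis is left unchanged; the others are replaced by their component
along the complement of the range of the oblique projection `R`. If all indices `≥ N` outside `M`
enjoy, together with a finite set of indices, common lower bounds, then so do the modified vectors:
`y = R y + (1 - R) y`, the first part is controlled by the Riesz basis, and the second one lies
in the span of the original vectors, where testing against `(1 - R)* z` turns their lower bound
into one for the modified vectors. -/
theorem exists_lowerBound_oblique (hB : IsBessel 𝕜 f B) (hr : RieszLowerBound 𝕜 f I c) (hc : 0 < c)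
    {N : ℕ} {D M : Finset ℕ} (hA : 0 < A)
    (hlow : ∀ E ⊆ Set.Ici N, LowerBound 𝕜 f (D ∪ E) A)
    (hDM : ∀ i ∈ D, f i ∈ Submodule.span 𝕜 (f '' (I ∩ M)))
    (hN : ∀ i ≥ N, f i ∈ Submodule.span 𝕜 (f '' (I ∩ D ∪ I ∩ Set.Ici N)))
    (hMI : (M : Set ℕ) ⊆ I) {R : H →L[𝕜] H}
    (hR : ∀ x, R x ∈ Submodule.span 𝕜 (f '' M)) (hRM : ∀ j ∈ M, R (f j) = f j)
    (hRI : ∀ j ∈ I, j ∉ M → R (f j) = 0) {w : ℕ → H} (hwI : ∀ i ∈ I, w i = f i)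
    (hw : ∀ i ∉ I, w i = f i - R (f i)) {B' : ℝ} (hwB : IsBessel 𝕜 w B') {T : Set ℕ}
    (hT : ∀ i ∈ T, i < N → f i ∈ Submodule.span 𝕜 (f '' M)) :
    ∃ A', 0 < A' ∧ ∀ s ⊆ T, LowerBound 𝕜 w s A' := by
  have hRspan : ∀ x ∈ Submodule.span 𝕜 (f '' (M : Set ℕ)), R x = x := by
    intro x hx
    induction hx using Submodule.span_induction with
    | mem x h => obtain ⟨j, hj, rfl⟩ := h; exact hRM j hj
    | zero => simp
    | add x y _ _ hx hy => rw [map_add, hx, hy]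
    | smul a x _ hx => rw [map_smul, hx]
  have hRR : ∀ x, R (R x) = R x := fun x => hRspan _ (hR x)
  set P : H →L[𝕜] H := 1 - R with hP
  have hPx : ∀ x, P x = x - R x := fun x => rfl
  have hPP : ∀ x, P (P x) = P x := fun x => by simp [hPx, hRR]
  have hwv : ∀ i, i ∉ M → w i = P (f i) := by
    intro i hi
    by_cases hiI : i ∈ I
    · rw [hwI i hiI, hPx, hRI i hiI hi, sub_zero]
    · rw [hw i hiI, hPx]
  set m := 2 * (c⁻¹ * ‖R‖ ^ 2 + A⁻¹ * ‖P‖ ^ 2) + 1 with hm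
  have hm0 : 0 < m := by positivity
  refine ⟨m⁻¹, by positivity, fun s hs => .of_norm_inner_sq_le fun y hy z => ?_⟩
  have he0 : 0 ≤ energy 𝕜 w s z := energy_nonneg z
  -- the component in the span of the finitely many basis vectors
  have h1 : ‖(inner 𝕜 (R y) z : 𝕜)‖ ^ 2 ≤ c⁻¹ * ((‖R‖ * ‖y‖) ^ 2 * energy 𝕜 w s z) := by
    have hmem : R y ∈ Submodule.span 𝕜 (f '' (s ∩ M)) := by
      have : Submodule.span 𝕜 (w '' s) ≤
          (Submodule.span 𝕜 (f '' (s ∩ M))).comap R.toLinearMap := by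
        refine Submodule.span_le.2 ?_
        rintro _ ⟨i, hi, rfl⟩
        change R (w i) ∈ Submodule.span 𝕜 (f '' (s ∩ M))
        by_cases hiM : i ∈ M
        · rw [hwI i (hMI hiM), hRM i hiM]
          exact Submodule.subset_span ⟨i, ⟨hi, hiM⟩, rfl⟩
        · rw [hwv i hiM, hPx, map_sub, hRR, sub_self]
          exact zero_mem _
      exact this hy
    have h2 := (hr.lowerBound hc hB (s := s ∩ M)
      (Set.inter_subset_right.trans hMI)).mul_norm_inner_sq_le hc.le hB hmem z
    rw [energy_congr (g := w) (y := z) fun i hi => by rw [hwI i (hMI hi.2)]] at h2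
    rw [inv_mul_eq_div, le_div_iff₀ hc, mul_comm]
    refine h2.trans (mul_le_mul (pow_le_pow_left₀ (norm_nonneg _) (R.le_opNorm y) 2)
      (hwB.energy_mono Set.inter_subset_left z) (energy_nonneg _) (by positivity))
  -- the component in the complement
  have h2 : ‖(inner 𝕜 (P y) z : 𝕜)‖ ^ 2 ≤ A⁻¹ * ((‖P‖ * ‖y‖) ^ 2 * energy 𝕜 w s z) := by
    set Δ : Set ℕ := {i | i ∈ s ∧ N ≤ i ∧ i ∉ M} with hΔ
    set E : Set ℕ := Δ ∪ (M ∩ Set.Ici N) with hE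
    have hEN : E ⊆ Set.Ici N := Set.union_subset (fun i hi => hi.2.1) Set.inter_subset_right
    have hRf : ∀ i ≥ N, R (f i) ∈ Submodule.span 𝕜 (f '' (D ∪ E)) := by
      intro i hi
      have : Submodule.span 𝕜 (f '' (I ∩ D ∪ I ∩ Set.Ici N)) ≤
          (Submodule.span 𝕜 (f '' (D ∪ E))).comap R.toLinearMap := by
        refine Submodule.span_le.2 ?_
        rintro _ ⟨j, hj, rfl⟩
        change R (f j) ∈ Submodule.span 𝕜 (f '' (D ∪ E))
        have hjI : j ∈ I := hj.elim (fun h => h.1) fun h => h.1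
        by_cases hjM : j ∈ M
        · rw [hRM j hjM]
          refine Submodule.subset_span ⟨j, ?_, rfl⟩
          exact hj.elim (fun h => Or.inl h.2) fun h => Or.inr (Or.inr ⟨hjM, h.2⟩)
        · rw [hRI j hjI hjM]
          exact zero_mem _
      exact this (hN i hi)
    have hmem : P y ∈ Submodule.span 𝕜 (f '' (D ∪ E)) := by
      have : Submodule.span 𝕜 (w '' s) ≤
          (Submodule.span 𝕜 (f '' (D ∪ E))).comap P.toLinearMap := by
        refine Submodule.span_le.2 ?_
        rintro _ ⟨i, hi, rfl⟩
        change P (w i) ∈ Submodule.span 𝕜 (f '' (D ∪ E))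
        by_cases hiM : i ∈ M
        · rw [hwI i (hMI hiM), hPx, hRM i hiM, sub_self]
          exact zero_mem _
        rw [hwv i hiM, hPP, hPx]
        rcases lt_or_ge i N with hiN | hiN
        · rw [hRspan _ (hT i (hs hi) hiN), sub_self]
          exact zero_mem _
        · exact sub_mem (Submodule.subset_span ⟨i, Or.inr (Or.inl ⟨hi, hiN, hiM⟩), rfl⟩)
            (hRf i hiN)
      exact this hy
    have h3 := (hlow E hEN).mul_norm_inner_sq_le hA.le hB hmem
      (ContinuousLinearMap.adjoint P z)
    rw [ContinuousLinearMap.adjoint_inner_right, hPP,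
      energy_eq_of_subset (s := Δ) (t := D ∪ E) (fun i hi => Or.inr (Or.inl hi)) fun i hi hiΔ => ?_,
      energy_congr (g := w) (y := z) fun i hi => by
        rw [ContinuousLinearMap.adjoint_inner_right, hwv i hi.2.2]] at h3
    · rw [inv_mul_eq_div, le_div_iff₀ hA, mul_comm]
      refine h3.trans (mul_le_mul (pow_le_pow_left₀ (norm_nonneg _) (P.le_opNorm y) 2)
        (hwB.energy_mono (fun i hi => hi.1) z) (energy_nonneg _) (by positivity))
    · have hzero : P (f i) = 0 := by
        rw [hPx, sub_eq_zero]
        refine (hRspan _ ?_).symm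
        rcases hi with hi | hi | hi
        · exact Submodule.span_mono (Set.image_mono Set.inter_subset_right) (hDM i hi)
        · exact absurd hi hiΔ
        · exact Submodule.subset_span ⟨i, hi.1, rfl⟩
      rw [ContinuousLinearMap.adjoint_inner_right, hzero, inner_zero_left]
  have hsum : (inner 𝕜 y z : 𝕜) = inner 𝕜 (R y) z + inner 𝕜 (P y) z := by
    rw [← inner_add_left, hPx]; simp
  rw [inv_mul_eq_div, div_le_iff₀ hm0, hsum]
  calc ‖(inner 𝕜 (R y) z + inner 𝕜 (P y) z : 𝕜)‖ ^ 2
      ≤ (‖(inner 𝕜 (R y) z : 𝕜)‖ + ‖(inner 𝕜 (P y) z : 𝕜)‖) ^ 2 :=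
        pow_le_pow_left₀ (norm_nonneg _) (norm_add_le _ _) 2
    _ ≤ 2 * (‖(inner 𝕜 (R y) z : 𝕜)‖ ^ 2 + ‖(inner 𝕜 (P y) z : 𝕜)‖ ^ 2) := add_sq_le
    _ ≤ 2 * (c⁻¹ * ((‖R‖ * ‖y‖) ^ 2 * energy 𝕜 w s z)
          + A⁻¹ * ((‖P‖ * ‖y‖) ^ 2 * energy 𝕜 w s z)) := by gcongr
    _ = (m - 1) * (‖y‖ ^ 2 * energy 𝕜 w s z) := by rw [hm]; ring
    _ ≤ m * (‖y‖ ^ 2 * energy 𝕜 w s z) := by gcongr; linarith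
    _ = _ := by ring

/-- Every frame with the subframe property has a decomposition. -/
theorem HasSubframeProperty.nonempty_decomposition (hsub : HasSubframeProperty 𝕜 f)
    (hf : IsFrame 𝕜 f) : Nonempty (SubframeDecomposition 𝕜 f) := by
  classical
  obtain ⟨B, hB⟩ := hf.exists_isBessel
  obtain ⟨N, D, A, I, c, hA, hc, hDN, hlow, hr, htop, hD, hN⟩ := hsub.exists_rieszSubfamily hf
  obtain ⟨A₁, B₁, hA₁, -, hI⟩ := hsub I
  have hI := hI.lowerBound
  set S := Submodule.span 𝕜 (f '' I) with hS
  have hIS : ∀ i ∈ I, f i ∈ S := fun i hi => Submodule.subset_span ⟨i, hi, rfl⟩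
  have hNS : ∀ i ≥ N, f i ∈ S := fun i hi => Submodule.span_mono (Set.image_mono
    (Set.union_subset Set.inter_subset_left Set.inter_subset_left)) (hN i hi)
  -- `M` contains the basis indices below `N`, and those needed to expand the vectors below `N`
  -- of finite support
  have hfin : ∀ i, ∃ F : Finset ℕ, ↑F ⊆ I ∧ (f i ∈ S → f i ∈ Submodule.span 𝕜 (f '' F)) := by
    intro i
    by_cases hi : f i ∈ S
    · obtain ⟨F, hF, h⟩ := exists_finset_mem_span hi
      exact ⟨F, hF, fun _ => h⟩
    · exact ⟨∅, by simp, fun h => absurd h hi⟩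
  choose F hFI hF using hfin
  set M : Finset ℕ := {i ∈ Finset.range N | i ∈ I} ∪ (Finset.range N).biUnion F with hM
  have hMI : (M : Set ℕ) ⊆ I := by
    intro i hi
    rcases Finset.mem_union.1 hi with hi | hi
    · exact (Finset.mem_filter.1 hi).2
    · obtain ⟨j, -, hj⟩ := Finset.mem_biUnion.1 hi
      exact hFI j hj
  have hIM : ∀ i ∈ I, i < N → i ∈ M := fun i hi hiN =>
    Finset.mem_union_left _ (Finset.mem_filter.2 ⟨Finset.mem_range.2 hiN, hi⟩)
  have hSM : ∀ i < N, f i ∈ S → f i ∈ Submodule.span 𝕜 (f '' M) := fun i hiN hi =>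
    Submodule.span_mono (Set.image_mono fun j hj =>
      Finset.mem_union_right _ (Finset.mem_biUnion.2 ⟨i, Finset.mem_range.2 hiN, hj⟩)) (hF i hi)
  obtain ⟨R, hRmem, hRM, hRI, hRsum⟩ := hr.exists_obliqueProjection hc hB htop hI hA₁ hMI
  set Γ : Set ℕ := {i | f i ∈ S ∧ i ∉ I} with hΓ
  have hdisj : Disjoint I Γ := Set.disjoint_left.2 fun i hi hi' => hi'.2 hi
  set w : ℕ → H := fun i => if i ∈ I then f i else f i - R (f i) with hw
  have hwI : ∀ i ∈ I, w i = f i := fun i hi => if_pos hi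
  have hwI' : ∀ i ∉ I, w i = f i - R (f i) := fun i hi => if_neg hi
  have hfB := hB.map (1 - R)
  have hwB : IsBessel 𝕜 w (B + B * ‖(1 : H →L[𝕜] H) - R‖ ^ 2) := by
    have hpt : ∀ x i, ‖(inner 𝕜 (w i) x : 𝕜)‖ ^ 2 ≤ ‖(inner 𝕜 (f i) x : 𝕜)‖ ^ 2
        + ‖(inner 𝕜 ((1 - R : H →L[𝕜] H) (f i)) x : 𝕜)‖ ^ 2 := by
      intro x i
      by_cases hi : i ∈ I
      · rw [hwI i hi]; exact le_add_of_nonneg_right (by positivity)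
      · rw [hwI' i hi]; exact le_add_of_nonneg_left (by positivity)
    have hs : ∀ x, Summable fun i => ‖(inner 𝕜 (w i) x : 𝕜)‖ ^ 2 := fun x =>
      ((hB.summable x).add (hfB.summable x)).of_nonneg_of_le (fun _ => by positivity) (hpt x)
    refine ⟨add_nonneg hB.nonneg hfB.nonneg, hs, fun x => ?_⟩
    refine ((hs x).tsum_le_tsum (hpt x) ((hB.summable x).add (hfB.summable x))).trans ?_
    rw [(hB.summable x).tsum_add (hfB.summable x), add_mul]
    exact add_le_add (hB.le x) (hfB.le x)
  obtain ⟨A', hA', hwlow⟩ := exists_lowerBound_oblique hB hr hc hA hlow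
    (fun i hi => Submodule.span_mono (Set.image_mono
      (show I ∩ D ⊆ I ∩ M from fun j hj => ⟨hj.1, hIM j hj.1 (hDN j hj.2)⟩)) (hD i hi))
    hN hMI hRmem hRM hRI hwI hwI' hwB (T := I ∪ Γ) fun i hi hiN =>
      hSM i hiN (hi.elim (fun h => hIS i h) fun h => h.1)
  set e : I ⊕ Γ → ℕ := Sum.elim (↑) (↑) with he
  have hinj : Function.Injective e :=
    Subtype.val_injective.sumElim Subtype.val_injective fun a b h =>
      Set.disjoint_left.1 hdisj a.2 (h ▸ b.2)
  have hwe : Sum.elim (fun i : I => f i) (fun i : Γ => f i - R (f i)) = w ∘ e := by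
    funext q
    rcases q with q | q
    · exact (hwI q q.2).symm
    · exact (hwI' q q.2.2).symm
  have hcompl : ∀ x, x - R x ∈ closedSpan 𝕜 (fun j : ↥(I \ (M : Set ℕ)) => f j) := by
    intro x
    have hcl : IsClosed (((closedSpan 𝕜 (fun j : ↥(I \ (M : Set ℕ)) => f j)).comap
        (1 - R : H →L[𝕜] H).toLinearMap : Submodule 𝕜 H) : Set H) :=
      (Submodule.isClosed_topologicalClosure _).preimage (1 - R : H →L[𝕜] H).continuous
    refine Submodule.topologicalClosure_minimal S (Submodule.span_le.2 ?_) hcl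
      (htop ▸ Submodule.mem_top : x ∈ S.topologicalClosure)
    rintro _ ⟨j, hj, rfl⟩
    change f j - R (f j) ∈ closedSpan 𝕜 (fun j : ↥(I \ (M : Set ℕ)) => f j)
    by_cases hjM : j ∈ M
    · rw [hRM j hjM, sub_self]; exact zero_mem _
    · rw [hRI j hj hjM, sub_zero]
      exact Submodule.le_topologicalClosure _ (Submodule.subset_span ⟨⟨j, hj, hjM⟩, rfl⟩)
  exact ⟨{
    I := I
    Γ := Γ
    K := {i ∈ Finset.range N | f i ∉ S}
    disjoint_I_Γ := hdisj
    disjoint_I_K := Set.disjoint_left.2 fun i hi hi' =>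
      (Finset.mem_filter.1 hi').2 (Submodule.subset_span ⟨i, hi, rfl⟩)
    disjoint_Γ_K := Set.disjoint_left.2 fun i hi hi' => (Finset.mem_filter.1 hi').2 hi.1
    union_eq := Set.eq_univ_of_forall fun i => by
      by_cases hi : i ∈ I
      · exact Or.inl (Or.inl hi)
      by_cases hiS : f i ∈ S
      · exact Or.inl (Or.inr ⟨hiS, hi⟩)
      · refine Or.inr (Finset.mem_filter.2 ⟨Finset.mem_range.2 ?_, hiS⟩)
        by_contra hiN
        exact hiS (hNS i (not_lt.1 hiN))
    rieszBasis := hr.isRieszBasis hc hB htop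
    M := M
    M_subset := hMI
    h₁ := fun i => f i - R (f i)
    h₂ := fun i => R (f i)
    add_eq := fun i => (sub_add_cancel _ _).symm
    h₂_mem := fun i => hRmem _
    h₁_mem := fun i => hcompl _
    infinite_support := fun i hi =>
      hr.hasInfiniteSupport hc hB htop hI hA₁ (Finset.mem_filter.1 hi).2
    summable_h₂ := hRsum.comp_injective Subtype.val_injective
    rieszFrame := by
      rw [hwe]
      refine isRieszFrame_of_lowerBound (hwB.comp hinj) hA' (fun s => ?_) ?_
      · refine (lowerBound_comp_iff e hinj s).2 (hwlow _ ?_)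
        rintro _ ⟨q | q, -, rfl⟩
        exacts [Or.inl q.2, Or.inr q.2]
      · rw [eq_top_iff, ← htop, hS]
        refine Submodule.topologicalClosure_mono (Submodule.span_mono ?_)
        rintro _ ⟨i, hi, rfl⟩
        exact ⟨Sum.inl ⟨i, hi⟩, hwI i hi⟩ }⟩

end

end FrameTheory

theorem theorem4p1 {𝕜 H : Type*} [RCLike 𝕜] [NormedAddCommGroup H] [InnerProductSpace 𝕜 H]
    [CompleteSpace H] (f : ℕ → H) (hf : FrameTheory.IsFrame 𝕜 f)
    (hsub : FrameTheory.HasSubframeProperty 𝕜 f) :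
    List.TFAE [
      ∃ D : FrameTheory.SubframeDecomposition 𝕜 f, D.K = ∅,
      ∀ D : FrameTheory.SubframeDecomposition 𝕜 f, D.K = ∅,
      ∃ σ : Equiv.Perm ℕ, FrameTheory.ProjectionMethod 𝕜 (f ∘ σ),
      ∀ σ : Equiv.Perm ℕ, FrameTheory.StrongProjectionMethod 𝕜 (f ∘ σ)] := by
  tfae_have 1 → 4 := fun ⟨D, hD⟩ σ => D.strongProjectionMethod hD hf hsub σ
  tfae_have 4 → 3 := fun h => ⟨1, (h 1).projectionMethod⟩
  tfae_have 3 → 2 := fun ⟨_, h⟩ D => D.K_eq_empty h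
  tfae_have 2 → 1 := fun h =>
    (hsub.nonempty_decomposition hf).elim fun D => ⟨D, h D⟩
  tfae_finish
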